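/- Let $d\ge 1$, let $\Omega\subset\mathbb{R}^d$ be a bounded open set, let $y_d,u_d\in L^2(\Omega)$ and $\nu>0$. Put $a(y,v)=\int_\Omega \nabla y\cdot\nabla v\,dx$ for $y,v\in H_0^1(\Omega)$ and $$J(y,u)=\tfrac12\|y-y_d\|_{L^2(\Omega)}^2+\tfrac{\nu}{2}\|u-u_d\|_{L^2(\Omega)}^2 .$$ Consider the optimal control problem $$\text{(P)}\qquad \min_{(y,u)\in H_0^1(\Omega)\times L^2(\Omega)} J(y,u)\quad\text{s.t.}\quad a(y,v-y)+\|v\|_{L^1(\Omega)}-\|y\|_{L^1(\Omega)}\ge \int_\Omega u\,(v-y)\,dx\quad\forall v\in H_0^1(\Omega),$$ and, for $\bar u\in L^2(\Omega)$ and $\gamma>0$, the penalized and regularized problem $$\text{(P}_\gamma\text{)}\qquad \min_{(y,u)\in H_0^1(\Omega)\times L^2(\Omega)} J(y,u)+\|u-\bar u\|_{L^2(\Omega)}^2\quad\text{s.t.}\quad a(y,v)+\frac{2}{\pi}\int_\Omega \arctan(\gamma y)\,v\,dx=\int_\Omega u\,v\,dx\quad\forall v\in H_0^1(\Omega).$$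 A control $u\in L^2(\Omega)$ is called a local solution of one of these problems if there are a state $y\in H_0^1(\Omega)$ such that $(y,u)$ is feasible and an $\varepsilon>0$ such that the objective value at $(y,u)$ is at most the objective value at $(y',u')$ for every feasible pair $(y',u')$ with $\|u'-u\|_{L^2(\Omega)}\le\varepsilon$. Let $\bar u\in L^2(\Omega)$ be a local solution of (P). Then there is a family $(\bar u_\gamma)_{\gamma>0}$ in $L^2(\Omega)$ such that $\bar u_\gamma$ is a local solution of (P$_\gamma$) (formed with this $\bar u$) for every $\gamma>0$, and $\bar u_\gamma\to\bar u$ strongly in $L^2(\Omega)$ as $\gamma\to\infty$. -/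

import Mathlib

open MeasureTheory Filter Topology TopologicalSpace
open scoped Gradient Distributions

noncomputable section

namespace VIControl

/-- The Euclidean space `ℝ^d`. -/
abbrev Space (d : ℕ) := EuclideanSpace ℝ (Fin d)

variable {d : ℕ}

/-- The Lebesgue space `L²(Ω)`. -/
abbrev L2 (Ω : Opens (Space d)) :=
  Lp ℝ 2 ((volume : Measure (Space d)).restrict (Ω : Set (Space d)))

/-- The Lebesgue space `L²(Ω; ℝ^d)` of vector fields. -/
abbrev L2Vec (Ω : Opens (Space d)) :=
  Lp (Space d) 2 ((volume : Measure (Space d)).restrict (Ω : Set (Space d)))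

/-- `g` is the weak gradient of `y` on `Ω`: `∫_Ω y ∇φ = -∫_Ω φ g` (an identity of vectors)
for all test functions `φ ∈ C_c^∞(Ω)`. -/
def IsWeakGradient {Ω : Opens (Space d)} (y : L2 Ω) (g : L2Vec Ω) : Prop :=
  ∀ φ : 𝓓(Ω, ℝ),
    ∫ x in (Ω : Set (Space d)), y x • ∇ φ x = - ∫ x in (Ω : Set (Space d)), φ x • g x

lemma gradient_add_test {Ω : Opens (Space d)} (φ ψ : 𝓓(Ω, ℝ)) (x : Space d) :
    ∇ (φ + ψ : 𝓓(Ω, ℝ)) x = ∇ φ x + ∇ ψ x := by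
  have h1 : DifferentiableAt ℝ φ x := (φ.contDiff.differentiable (by simp)) x
  have h2 : DifferentiableAt ℝ ψ x := (ψ.contDiff.differentiable (by simp)) x
  simp only [gradient, FunLike.coe_add]
  rw [fderiv_add h1 h2, map_add]

lemma gradient_smul_test {Ω : Opens (Space d)} (c : ℝ) (φ : 𝓓(Ω, ℝ)) (x : Space d) :
    ∇ (c • φ : 𝓓(Ω, ℝ)) x = c • ∇ φ x := by
  have h1 : DifferentiableAt ℝ φ x := (φ.contDiff.differentiable (by simp)) x
  simp only [gradient, FunLike.coe_smul]
  rw [fderiv_const_smul h1]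
  simp

lemma continuous_gradient_test {Ω : Opens (Space d)} (φ : 𝓓(Ω, ℝ)) : Continuous (∇ φ) :=
  (InnerProductSpace.toDual ℝ (Space d)).symm.continuous.comp
    (φ.contDiff.continuous_fderiv (by simp))

lemma hasCompactSupport_gradient_test {Ω : Opens (Space d)} (φ : 𝓓(Ω, ℝ)) :
    HasCompactSupport (∇ φ) :=
  (φ.hasCompactSupport.fderiv (𝕜 := ℝ)).comp_left
    (g := (InnerProductSpace.toDual ℝ (Space d)).symm) (map_zero _)

lemma integrable_smul_gradient {Ω : Opens (Space d)} (y : L2 Ω) (φ : 𝓓(Ω, ℝ)) :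
    Integrable (fun x => y x • ∇ φ x)
      ((volume : Measure (Space d)).restrict (Ω : Set (Space d))) :=
  memLp_one_iff_integrable.1 <| MemLp.smul (p := 2) (q := 2) (r := 1)
    ((continuous_gradient_test φ).memLp_of_hasCompactSupport (hasCompactSupport_gradient_test φ))
    (Lp.memLp y)

lemma integrable_test_smul {Ω : Opens (Space d)} (φ : 𝓓(Ω, ℝ)) (g : L2Vec Ω) :
    Integrable (fun x => φ x • g x)
      ((volume : Measure (Space d)).restrict (Ω : Set (Space d))) :=
  memLp_one_iff_integrable.1 <| MemLp.smul (p := 2) (q := 2) (r := 1)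
    (Lp.memLp g) (φ.continuous.memLp_of_hasCompactSupport φ.hasCompactSupport)

/-- The Sobolev space `H¹(Ω)`: pairs `(y, ∇y)` of an `L²` function and its (unique) weak gradient
in `L²`, with the norm `(‖y‖² + ‖∇y‖²)^{1/2}`. -/
def H1 (Ω : Opens (Space d)) : Submodule ℝ (WithLp 2 (L2 Ω × L2Vec Ω)) where
  carrier := {p | IsWeakGradient p.fst p.snd}
  zero_mem' := by
    intro φ
    have h1 : ∫ x in (Ω : Set (Space d)), (0 : L2 Ω) x • ∇ φ x
        = ∫ x in (Ω : Set (Space d)), (0 : Space d) := by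
      refine integral_congr_ae ?_
      filter_upwards [Lp.coeFn_zero ℝ 2 (volume.restrict (Ω : Set (Space d)))] with x hx
      rw [hx]; simp
    have h2 : ∫ x in (Ω : Set (Space d)), φ x • (0 : L2Vec Ω) x
        = ∫ x in (Ω : Set (Space d)), (0 : Space d) := by
      refine integral_congr_ae ?_
      filter_upwards [Lp.coeFn_zero (Space d) 2 (volume.restrict (Ω : Set (Space d)))] with x hx
      rw [hx]; simp
    rw [WithLp.zero_fst, WithLp.zero_snd, h1, h2]
    simp
  add_mem' := by
    intro p q hp hq φ
    have h1 : ∫ x in (Ω : Set (Space d)), (p.fst + q.fst) x • ∇ φ x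
        = ∫ x in (Ω : Set (Space d)), (p.fst x • ∇ φ x + q.fst x • ∇ φ x) := by
      refine integral_congr_ae ?_
      filter_upwards [Lp.coeFn_add p.fst q.fst] with x hx
      rw [hx, Pi.add_apply, add_smul]
    have h2 : ∫ x in (Ω : Set (Space d)), φ x • (p.snd + q.snd) x
        = ∫ x in (Ω : Set (Space d)), (φ x • p.snd x + φ x • q.snd x) := by
      refine integral_congr_ae ?_
      filter_upwards [Lp.coeFn_add p.snd q.snd] with x hx
      rw [hx, Pi.add_apply, smul_add]
    rw [WithLp.add_fst, WithLp.add_snd, h1, h2,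
      integral_add (integrable_smul_gradient _ _) (integrable_smul_gradient _ _),
      integral_add (integrable_test_smul _ _) (integrable_test_smul _ _), hp φ, hq φ, neg_add]
  smul_mem' := by
    intro c p hp φ
    have h1 : ∫ x in (Ω : Set (Space d)), (c • p.fst) x • ∇ φ x
        = ∫ x in (Ω : Set (Space d)), c • (p.fst x • ∇ φ x) := by
      refine integral_congr_ae ?_
      filter_upwards [Lp.coeFn_smul c p.fst] with x hx
      rw [hx, Pi.smul_apply, smul_assoc]
    have h2 : ∫ x in (Ω : Set (Space d)), φ x • (c • p.snd) x
        = ∫ x in (Ω : Set (Space d)), c • (φ x • p.snd x) := by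
      refine integral_congr_ae ?_
      filter_upwards [Lp.coeFn_smul c p.snd] with x hx
      rw [hx, Pi.smul_apply, smul_comm]
    rw [WithLp.smul_fst, WithLp.smul_snd, h1, h2, integral_smul, integral_smul, hp φ, smul_neg]

/-- The subspace of `H¹(Ω)` formed by (the classes of) the test functions `φ ∈ C_c^∞(Ω)`. -/
def testH1 (Ω : Opens (Space d)) : Submodule ℝ (H1 Ω) where
  carrier := {p | ∃ φ : 𝓓(Ω, ℝ),
    p.1.fst =ᵐ[volume.restrict (Ω : Set (Space d))] φ ∧
    p.1.snd =ᵐ[volume.restrict (Ω : Set (Space d))] ∇ φ}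
  zero_mem' := by
    refine ⟨0, ?_, ?_⟩
    · filter_upwards [Lp.coeFn_zero ℝ 2 (volume.restrict (Ω : Set (Space d)))] with x hx
      simpa using hx
    · filter_upwards [Lp.coeFn_zero (Space d) 2 (volume.restrict (Ω : Set (Space d)))] with x hx
      have : (∇ (0 : 𝓓(Ω, ℝ)) : Space d → Space d) x = 0 := by
        have := gradient_smul_test (0 : ℝ) (0 : 𝓓(Ω, ℝ)) x
        simpa only [zero_smul] using this
      rw [this]; simpa using hx
  add_mem' := by
    rintro p q ⟨φ, h1, h2⟩ ⟨ψ, h3, h4⟩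
    refine ⟨φ + ψ, ?_, ?_⟩
    · filter_upwards [Lp.coeFn_add p.1.fst q.1.fst, h1, h3] with x hx h h'
      refine hx.trans ?_
      rw [Pi.add_apply, h, h', FunLike.coe_add, Pi.add_apply]
    · filter_upwards [Lp.coeFn_add p.1.snd q.1.snd, h2, h4] with x hx h h'
      refine hx.trans ?_
      rw [Pi.add_apply, h, h', gradient_add_test]
  smul_mem' := by
    rintro c p ⟨φ, h1, h2⟩
    refine ⟨c • φ, ?_, ?_⟩
    · filter_upwards [Lp.coeFn_smul c p.1.fst, h1] with x hx h
      refine hx.trans ?_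
      rw [Pi.smul_apply, h, FunLike.coe_smul, Pi.smul_apply]
    · filter_upwards [Lp.coeFn_smul c p.1.snd, h2] with x hx h
      refine hx.trans ?_
      rw [Pi.smul_apply, h, gradient_smul_test]

/-- The Sobolev space `H₀¹(Ω)`: the closure of `C_c^∞(Ω)` in `H¹(Ω)`. -/
def H01 (Ω : Opens (Space d)) : Submodule ℝ (H1 Ω) := (testH1 Ω).topologicalClosure

variable {Ω : Opens (Space d)}

/-- The function `y ∈ L²(Ω)` underlying `y ∈ H₀¹(Ω)`. -/
def stateFn (y : H01 Ω) : L2 Ω := y.1.1.fst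

/-- The weak gradient `∇y ∈ L²(Ω; ℝ^d)` of `y ∈ H₀¹(Ω)`. -/
def stateGrad (y : H01 Ω) : L2Vec Ω := y.1.1.snd

/-- The bilinear form `a(y, v) = ∫_Ω ∇y · ∇v`. -/
def dirichletForm (y v : H01 Ω) : ℝ :=
  ∫ x in (Ω : Set (Space d)), inner ℝ (stateGrad y x) (stateGrad v x)

/-- The norm `‖y‖_{L¹(Ω)} = ∫_Ω |y|`. -/
def normL1 (y : L2 Ω) : ℝ := ∫ x in (Ω : Set (Space d)), |y x|

/-- The pairing `⟨u, v⟩ = ∫_Ω u v` for `u ∈ L²(Ω)` and `v ∈ H₀¹(Ω)`. -/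
def pairing (u : L2 Ω) (v : H01 Ω) : ℝ := ∫ x in (Ω : Set (Space d)), u x * stateFn v x

/-- `y` solves the variational inequality of the second kind with right-hand side `u`:
`a(y, v - y) + ‖v‖_{L¹} - ‖y‖_{L¹} ≥ ⟨u, v - y⟩` for all `v ∈ H₀¹(Ω)`. -/
def SolvesVI (u : L2 Ω) (y : H01 Ω) : Prop :=
  ∀ v : H01 Ω,
    dirichletForm y (v - y) + normL1 (stateFn v) - normL1 (stateFn y) ≥ pairing u (v - y)

/-- `y` solves the regularized equation with parameter `γ` and right-hand side `u`:
`a(y, v) + (2/π) ∫_Ω arctan(γ y) v = ⟨u, v⟩` for all `v ∈ H₀¹(Ω)`. -/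
def SolvesRegularized (γ : ℝ) (u : L2 Ω) (y : H01 Ω) : Prop :=
  ∀ v : H01 Ω,
    dirichletForm y v
      + 2 / Real.pi * ∫ x in (Ω : Set (Space d)), Real.arctan (γ * stateFn y x) * stateFn v x
      = pairing u v

/-- The objective `J(y, u) = ½ ‖y - y_d‖²_{L²} + (ν/2) ‖u - u_d‖²_{L²}`. -/
def objective (yd ud : L2 Ω) (ν : ℝ) (y : H01 Ω) (u : L2 Ω) : ℝ :=
  1 / 2 * ‖stateFn y - yd‖ ^ 2 + ν / 2 * ‖u - ud‖ ^ 2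

/-- The control `u` is a local solution of "minimize `F(y, u)` over all pairs `(y, u)` that satisfy
the state constraint `A u y`": together with a state `y` it is feasible, and its value is minimal
among all feasible pairs with a control in a closed `L²(Ω)`-ball of positive radius around `u`. -/
def IsLocalSolution (A : L2 Ω → H01 Ω → Prop) (F : H01 Ω → L2 Ω → ℝ) (u : L2 Ω) : Prop :=
  ∃ y : H01 Ω, A u y ∧
    ∃ ε > 0, ∀ (u' : L2 Ω) (y' : H01 Ω), A u' y' → ‖u' - u‖ ≤ ε → F y u ≤ F y' u'

/-- Local solutions of the problem (P): minimize `J(y, u)` subject to the variational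
inequality. -/
def IsLocalSolutionP (yd ud : L2 Ω) (ν : ℝ) (u : L2 Ω) : Prop :=
  IsLocalSolution SolvesVI (objective yd ud ν) u

/-- Local solutions of the problem (P_γ): minimize `J(y, u) + ‖u - ubar‖²_{L²}` subject to the
regularized equation. -/
def IsLocalSolutionPγ (yd ud : L2 Ω) (ν : ℝ) (ubar : L2 Ω) (γ : ℝ) (u : L2 Ω) : Prop :=
  IsLocalSolution (SolvesRegularized γ)
    (fun y u => objective yd ud ν y u + ‖u - ubar‖ ^ 2) u

end VIControl

end

/-!
Both control-to-state operators factor through the weak gradient `G` and the embedding `T` of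
`H₀¹(Ω)` into `L²(Ω)`, which enter only through two properties: `G` is bounded below (Poincaré) and
`T` is completely continuous (Rellich). Both follow from the estimate `‖y - A_r y‖ ≤ r ‖∇y‖` for the
average `A_r` over balls of radius `r`: for large `r` the average is small compared with `y`, and
for every `r` it is a completely continuous operator.

Since `(2/π) arctan (γ s) (t - s) ≤ |t| - |s| + 2/(πγ)`, solutions of the regularized equation solve
the variational inequality up to an error `O(1/γ)`. Hence the states converge strongly along
`γ → ∞` even when the controls converge only weakly, and the reduced objectives satisfy a
`Γ`-liminf inequality in the weak topology. Minimizing the penalized objectives over a fixed ball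
around the local solution then gives controls whose weak limit cannot have a smaller value than
the center, so the penalty term tends to `0` and the convergence is strong.
-/

open MeasureTheory Filter Topology TopologicalSpace
open scoped Gradient Distributions

noncomputable section

namespace VIControl

open scoped RealInnerProductSpace ENNReal NNReal

/-! ### Weak convergence in Hilbert spaces -/

lemma tendsto_of_norm_sub_sq_tendsto_zero {E ι : Type*} [SeminormedAddCommGroup E]
    {l : Filter ι} {x : ι → E} {a : E}
    (hx : Tendsto (fun i => ‖x i - a‖ ^ 2) l (𝓝 0)) : Tendsto x l (𝓝 a) := by
  rw [tendsto_iff_norm_sub_tendsto_zero]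
  simpa only [Real.sqrt_sq (norm_nonneg _), Real.sqrt_zero] using hx.sqrt

section WeakConvergence

variable {H K : Type*} [NormedAddCommGroup H] [InnerProductSpace ℝ H]
  [NormedAddCommGroup K] [InnerProductSpace ℝ K] {ι : Type*} {l : Filter ι}

/-- Weak convergence of `x` to `a` along `l` in a real inner product space. Functionals are
represented by vectors, so this is the weak topology only when the space is complete. -/
def WeakTendsto (x : ι → H) (l : Filter ι) (a : H) : Prop :=
  ∀ w, Tendsto (fun i => ⟪x i, w⟫) l (𝓝 ⟪a, w⟫)

lemma weakTendsto_const (a : H) : WeakTendsto (fun _ => a) l a := fun _ => tendsto_const_nhds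

lemma WeakTendsto.sub {x y : ι → H} {a b : H} (hx : WeakTendsto x l a) (hy : WeakTendsto y l b) :
    WeakTendsto (fun i => x i - y i) l (a - b) := fun w => by
  simpa only [inner_sub_left] using (hx w).sub (hy w)

lemma WeakTendsto.map [CompleteSpace H] [CompleteSpace K] {x : ι → H} {a : H}
    (hx : WeakTendsto x l a) (T : H →L[ℝ] K) : WeakTendsto (fun i => T (x i)) l (T a) := fun w => by
  simpa only [ContinuousLinearMap.adjoint_inner_right] using hx (T.adjoint w)

lemma WeakTendsto.exists_norm_le [CompleteSpace H] {x : ℕ → H} {a : H}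
    (hx : WeakTendsto x atTop a) : ∃ C, ∀ n, ‖x n‖ ≤ C := by
  obtain ⟨C, hC⟩ := banach_steinhaus (g := fun n => innerSL ℝ (x n)) fun w => by
    obtain ⟨C, hC⟩ := (hx w).norm.bddAbove_range
    exact ⟨C, fun n => hC ⟨n, rfl⟩⟩
  exact ⟨C, fun n => by simpa only [innerSL_apply_norm] using hC n⟩

lemma exists_subseq_weakTendsto [CompleteSpace H] [SeparableSpace H] {x : ℕ → H} {C : ℝ}
    (hx : ∀ n, ‖x n‖ ≤ C) :
    ∃ (a : H) (φ : ℕ → ℕ), StrictMono φ ∧ WeakTendsto (x ∘ φ) atTop a := by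
  obtain ⟨a, -, φ, hφ, ha⟩ := WeakDual.isSeqCompact_closedBall ℝ H 0 C
    (x := fun n => StrongDual.toWeakDual (InnerProductSpace.toDual ℝ H (x n)))
    fun n => by simpa [mem_closedBall_zero_iff] using hx n
  refine ⟨(InnerProductSpace.toDual ℝ H).symm (WeakDual.toStrongDual a), φ, hφ, fun w => ?_⟩
  rw [InnerProductSpace.toDual_symm_apply]
  exact (WeakDual.eval_continuous w).continuousAt.tendsto.comp ha

lemma WeakTendsto.tendsto_inner [CompleteSpace H] {x b : ℕ → H} {a c : H}
    (hx : WeakTendsto x atTop a) (hb : Tendsto b atTop (𝓝 c)) :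
    Tendsto (fun n => ⟪x n, b n⟫) atTop (𝓝 ⟪a, c⟫) := by
  obtain ⟨C, hC⟩ := hx.exists_norm_le
  have h0 : Tendsto (fun n => ⟪x n, b n - c⟫) atTop (𝓝 0) := by
    refine squeeze_zero_norm (fun n => (norm_inner_le_norm _ _).trans
      (mul_le_mul_of_nonneg_right (hC n) (norm_nonneg _))) ?_
    simpa using (tendsto_iff_norm_sub_tendsto_zero.1 hb).const_mul C
  simpa [inner_sub_right] using h0.add (hx c)

lemma two_mul_inner_sub_norm_sq_le (x y : H) : 2 * ⟪x, y⟫ - ‖y‖ ^ 2 ≤ ‖x‖ ^ 2 := by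
  linarith [norm_sub_sq_real x y, sq_nonneg ‖x - y‖]

lemma WeakTendsto.eventually_lt_norm_sq {x : ι → H} {a : H} (hx : WeakTendsto x l a) {m : ℝ}
    (hm : m < ‖a‖ ^ 2) : ∀ᶠ i in l, m < ‖x i‖ ^ 2 := by
  have hlim : Tendsto (fun i => 2 * ⟪x i, a⟫ - ‖a‖ ^ 2) l (𝓝 (2 * ⟪a, a⟫ - ‖a‖ ^ 2)) :=
    ((hx a).const_mul 2).sub_const _
  rw [real_inner_self_eq_norm_sq, two_mul, add_sub_cancel_right] at hlim
  filter_upwards [hlim.eventually_const_lt hm] with i hi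
  exact hi.trans_le (two_mul_inner_sub_norm_sq_le _ _)

lemma WeakTendsto.mem_closedBall [l.NeBot] {x : ι → H} {a c : H} {r : ℝ} (hx : WeakTendsto x l a)
    (hr : ∀ i, x i ∈ Metric.closedBall c r) : a ∈ Metric.closedBall c r := by
  simp only [mem_closedBall_iff_norm] at hr ⊢
  obtain ⟨i₀⟩ := l.nonempty_of_neBot
  refine le_of_sq_le_sq (not_lt.1 fun hlt => ?_) ((norm_nonneg _).trans (hr i₀))
  obtain ⟨i, hi⟩ := ((hx.sub (weakTendsto_const c)).eventually_lt_norm_sq hlt).exists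
  exact (pow_le_pow_left₀ (norm_nonneg _) (hr i) 2).not_gt hi

/-- A completely continuous operator: weakly convergent sequences have strongly convergent
images. -/
def IsCompletelyContinuous (T : H →L[ℝ] K) : Prop :=
  ∀ ⦃x : ℕ → H⦄ ⦃a : H⦄, WeakTendsto x atTop a → Tendsto (fun n => T (x n)) atTop (𝓝 (T a))

lemma IsCompletelyContinuous.adjoint [CompleteSpace H] [CompleteSpace K] {T : H →L[ℝ] K}
    (hT : IsCompletelyContinuous T) : IsCompletelyContinuous T.adjoint := by
  intro u b hu
  have hw : WeakTendsto (fun n => u n - b) atTop 0 := by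
    simpa only [sub_self] using hu.sub (weakTendsto_const b)
  have hTT : Tendsto (fun n => T (T.adjoint (u n - b))) atTop (𝓝 0) := by
    simpa only [map_zero] using hT (hw.map T.adjoint)
  have hlim := hw.tendsto_inner hTT
  rw [inner_zero_left] at hlim
  refine tendsto_of_norm_sub_sq_tendsto_zero (hlim.congr fun n => ?_)
  rw [← ContinuousLinearMap.adjoint_inner_left, real_inner_self_eq_norm_sq, map_sub]

end WeakConvergence

lemma IsCompletelyContinuous.of_forall_norm_le {H K : Type*} [NormedAddCommGroup H]
    [InnerProductSpace ℝ H] [CompleteSpace H] [NormedAddCommGroup K] [InnerProductSpace ℝ K]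
    {T : H →L[ℝ] K}
    (h : ∀ ε > 0, ∃ S : H →L[ℝ] K, IsCompletelyContinuous S ∧ ∀ y, ‖T y‖ ≤ ‖S y‖ + ε * ‖y‖) :
    IsCompletelyContinuous T := by
  intro x a hx
  have hxa : WeakTendsto (fun n => x n - a) atTop 0 := by
    simpa only [sub_self] using hx.sub (weakTendsto_const a)
  obtain ⟨C, hC⟩ := hxa.exists_norm_le
  have hC₀ : 0 ≤ C := (norm_nonneg _).trans (hC 0)
  rw [tendsto_iff_norm_sub_tendsto_zero]
  refine (tendsto_order.2 ⟨fun b hb => .of_forall fun n => hb.trans_le (norm_nonneg _),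
    fun b hb => ?_⟩)
  obtain ⟨S, hS, hTS⟩ := h (b / (2 * (C + 1))) (by positivity)
  have hSx : Tendsto (fun n => ‖S (x n - a)‖) atTop (𝓝 0) := by simpa using (hS hxa).norm
  filter_upwards [hSx.eventually_lt_const (half_pos hb)] with n hn
  have hε : b / (2 * (C + 1)) * ‖x n - a‖ ≤ b / 2 := by
    rw [div_mul_eq_mul_div, div_le_div_iff₀ (by positivity) two_pos]
    nlinarith [hC n]
  rw [← map_sub]
  linarith [hTS (x n - a)]

/-! ### Localization of minimizers -/

lemma isMinOn_add_norm_sub_sq_univ {E : Type*} [SeminormedAddCommGroup E]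
    {f : E → ℝ} {a x : E} {b r : ℝ} (hb : ∀ x, b ≤ f x) (hr : 0 ≤ r)
    (hab : f a ≤ b + r ^ 2)
    (hx : IsMinOn (fun x => f x + ‖x - a‖ ^ 2) (Metric.closedBall a r) x) :
    IsMinOn (fun x => f x + ‖x - a‖ ^ 2) Set.univ x := by
  intro y _
  by_cases hy : y ∈ Metric.closedBall a r
  · exact hx hy
  have ha : f x + ‖x - a‖ ^ 2 ≤ f a := by simpa using hx (Metric.mem_closedBall_self hr)
  rw [mem_closedBall_iff_norm, not_le] at hy
  have hy' : r ^ 2 ≤ ‖y - a‖ ^ 2 := pow_le_pow_left₀ hr hy.le 2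
  change f x + ‖x - a‖ ^ 2 ≤ f y + ‖y - a‖ ^ 2
  linarith [hb y]

section GammaLiminf

variable {H : Type*} [NormedAddCommGroup H] [InnerProductSpace ℝ H] {ι : Type*} {l : Filter ι}

/-- The lower half of weak sequential `Γ`-convergence of `f i` to `f₀` along `l`:
`f₀ a ≤ liminf f (k n) (x n)` whenever `k n` tends to `l` and `x n` tends weakly to `a`. For a
constant family this is weak sequential lower semicontinuity. -/
def IsWeakGammaLowerBound (f : ι → H → ℝ) (l : Filter ι) (f₀ : H → ℝ) : Prop :=
  ∀ ⦃k : ℕ → ι⦄, Tendsto k atTop l → ∀ ⦃x : ℕ → H⦄ ⦃a : H⦄, WeakTendsto x atTop a →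
    ∀ m < f₀ a, ∀ᶠ n in atTop, m < f (k n) (x n)

/-- Weak sequential lower semicontinuity. -/
abbrev WeaklyLowerSemicontinuous (f : H → ℝ) : Prop :=
  IsWeakGammaLowerBound (fun _ : Unit => f) ⊤ f

lemma IsWeakGammaLowerBound.add {f g : ι → H → ℝ} {f₀ g₀ : H → ℝ}
    (hf : IsWeakGammaLowerBound f l f₀) (hg : IsWeakGammaLowerBound g l g₀) :
    IsWeakGammaLowerBound (fun i x => f i x + g i x) l (fun x => f₀ x + g₀ x) := by
  intro k hk x a hx m hm
  obtain ⟨η, hη, hm⟩ : ∃ η > 0, m + 2 * η < f₀ a + g₀ a :=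
    ⟨(f₀ a + g₀ a - m) / 3, by linarith, by linarith⟩
  filter_upwards [hf hk hx (f₀ a - η) (by linarith), hg hk hx (g₀ a - η) (by linarith)] with n h h'
  linarith

lemma IsWeakGammaLowerBound.of_tendsto {f : ι → H → ℝ} {f₀ : H → ℝ}
    (hf : ∀ ⦃k : ℕ → ι⦄, Tendsto k atTop l → ∀ ⦃x : ℕ → H⦄ ⦃a : H⦄, WeakTendsto x atTop a →
      Tendsto (fun n => f (k n) (x n)) atTop (𝓝 (f₀ a))) : IsWeakGammaLowerBound f l f₀ :=
  fun _ hk _ _ hx _ hm => (hf hk hx).eventually_const_lt hm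

lemma isWeakGammaLowerBound_mul_norm_sub_sq {c : ℝ} (hc : 0 ≤ c) (b : H) :
    IsWeakGammaLowerBound (fun (_ : ι) x => c * ‖x - b‖ ^ 2) l fun x => c * ‖x - b‖ ^ 2 := by
  intro k _ x a hx m hm
  obtain rfl | hc := hc.eq_or_lt
  · simp_all
  simp only [← div_lt_iff₀' hc] at hm ⊢
  exact (hx.sub (weakTendsto_const b)).eventually_lt_norm_sq hm

lemma WeaklyLowerSemicontinuous.add_norm_sub_sq {f : H → ℝ} (hf : WeaklyLowerSemicontinuous f)
    (a : H) : WeaklyLowerSemicontinuous fun x => f x + ‖x - a‖ ^ 2 := by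
  simpa only [one_mul] using hf.add (isWeakGammaLowerBound_mul_norm_sub_sq zero_le_one a)

variable [CompleteSpace H] [SeparableSpace H]

theorem WeaklyLowerSemicontinuous.exists_isMinOn_closedBall {f : H → ℝ}
    (hf : WeaklyLowerSemicontinuous f) (a : H) {r : ℝ} (hr : 0 ≤ r) :
    ∃ x ∈ Metric.closedBall a r, IsMinOn f (Metric.closedBall a r) x := by
  obtain ⟨m, -, hm, hmem⟩ := exists_seq_tendsto_sInf
    ((Metric.nonempty_closedBall.2 hr).image fun x => (f x : EReal)) (OrderBot.bddBelow _)
  choose x hx hfx using hmem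
  obtain ⟨x₀, φ, hφ, hweak⟩ := exists_subseq_weakTendsto (x := x) (C := ‖a‖ + r) fun n =>
    norm_le_of_mem_closedBall (hx n)
  have hlim := hm.comp hφ.tendsto_atTop
  have hle : (f x₀ : EReal) ≤ sInf ((fun x => (f x : EReal)) '' Metric.closedBall a r) := by
    refine not_lt.1 fun hlt => ?_
    obtain ⟨c, hc, hc'⟩ := EReal.lt_iff_exists_real_btwn.1 hlt
    have hfc := hf (k := fun _ => ()) tendsto_top hweak c (EReal.coe_lt_coe_iff.1 hc')
    obtain ⟨n, hn, hn'⟩ := (hfc.and (hlim.eventually_lt_const hc)).exists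
    rw [Function.comp_apply, ← hfx, EReal.coe_lt_coe_iff] at hn'
    exact hn.not_gt hn'
  exact ⟨x₀, hweak.mem_closedBall fun n => hx _, fun y hy =>
    EReal.coe_le_coe_iff.1 (hle.trans (sInf_le ⟨y, hy, rfl⟩))⟩

theorem IsWeakGammaLowerBound.tendsto_of_le [l.IsCountablyGenerated] {f : ι → H → ℝ} {f₀ : H → ℝ}
    {a : H} {r : ℝ} {x : ι → H} (hf : IsWeakGammaLowerBound f l f₀)
    (hfa : Tendsto (fun i => f i a) l (𝓝 (f₀ a))) (ha : IsMinOn f₀ (Metric.closedBall a r) a)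
    (hxr : ∀ i, x i ∈ Metric.closedBall a r) (hx : ∀ i, f i (x i) + ‖x i - a‖ ^ 2 ≤ f i a) :
    Tendsto x l (𝓝 a) := by
  refine tendsto_of_subseq_tendsto fun k hk => ?_
  obtain ⟨b, φ, hφ, hweak⟩ := exists_subseq_weakTendsto (x := x ∘ k) (C := ‖a‖ + r) fun n =>
    norm_le_of_mem_closedBall (hxr _)
  have hk' : Tendsto (k ∘ φ) atTop l := hk.comp hφ.tendsto_atTop
  have hab : f₀ a ≤ f₀ b := ha (hweak.mem_closedBall fun n => hxr _)
  refine ⟨φ, tendsto_of_norm_sub_sq_tendsto_zero ?_⟩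
  refine tendsto_order.2 ⟨fun c hc => .of_forall fun n => hc.trans_le (sq_nonneg _), fun η hη => ?_⟩
  filter_upwards [hf hk' hweak (f₀ b - η / 2) (by linarith),
    (hfa.comp hk').eventually_lt_const (show f₀ a < f₀ a + η / 2 by linarith)] with n h₁ h₂
  have h₃ := hx (k (φ n))
  simp only [Function.comp_apply] at h₁ h₂
  linarith

lemma WeaklyLowerSemicontinuous.exists_isLocalMin_add_norm_sub_sq {f : H → ℝ} {b : ℝ}
    (hf : WeaklyLowerSemicontinuous f) (hb : ∀ x, b ≤ f x) (a : H) :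
    ∃ x, IsLocalMin (fun x => f x + ‖x - a‖ ^ 2) x := by
  obtain ⟨x, -, hx⟩ :=
    (hf.add_norm_sub_sq a).exists_isMinOn_closedBall a (Real.sqrt_nonneg (f a - b))
  refine ⟨x, (isMinOn_add_norm_sub_sq_univ hb (Real.sqrt_nonneg _) ?_ hx).isLocalMin univ_mem⟩
  rw [Real.sq_sqrt (sub_nonneg.2 (hb a)), add_sub_cancel]

/-- The penalty `‖x - a‖²` forces minimizers of `f i + ‖· - a‖²` over a fixed ball around the local
minimizer `a` of `f₀` to converge strongly to `a`, hence to leave the boundary of the ball, where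
they need not be local minimizers; for the remaining `i` a global minimizer is used instead. -/
theorem exists_isLocalMin_tendsto [l.IsCountablyGenerated] {f : ι → H → ℝ} {f₀ : H → ℝ} {a : H}
    {b : ℝ} {s : Set ι} (hs : s ∈ l) (hlsc : ∀ i ∈ s, WeaklyLowerSemicontinuous (f i))
    (hb : ∀ i ∈ s, ∀ x, b ≤ f i x) (hf : IsWeakGammaLowerBound f l f₀)
    (hfa : Tendsto (fun i => f i a) l (𝓝 (f₀ a))) (ha : IsLocalMin f₀ a) :
    ∃ u : ι → H, (∀ i ∈ s, IsLocalMin (fun x => f i x + ‖x - a‖ ^ 2) (u i)) ∧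
      Tendsto u l (𝓝 a) := by
  obtain ⟨r, hr, har⟩ : ∃ r > 0, IsMinOn f₀ (Metric.closedBall a r) a :=
    Metric.nhds_basis_closedBall.eventually_iff.1 ha
  have hball : ∀ i, ∃ x ∈ Metric.closedBall a r, f i x + ‖x - a‖ ^ 2 ≤ f i a ∧
      (i ∈ s → IsMinOn (fun x => f i x + ‖x - a‖ ^ 2) (Metric.closedBall a r) x) := by
    intro i
    have har : a ∈ Metric.closedBall a r := Metric.mem_closedBall_self hr.le
    by_cases hi : i ∈ s
    · obtain ⟨x, hxr, hx⟩ := ((hlsc i hi).add_norm_sub_sq a).exists_isMinOn_closedBall a hr.le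
      exact ⟨x, hxr, by simpa using hx har, fun _ => hx⟩
    · exact ⟨a, har, by simp, fun h => absurd h hi⟩
  choose x hxr hxa hxmin using hball
  have hxlim : Tendsto x l (𝓝 a) := hf.tendsto_of_le hfa har hxr hxa
  have hglue : ∀ i, ∃ u, (i ∈ s → IsLocalMin (fun x => f i x + ‖x - a‖ ^ 2) u) ∧
      (i ∈ s → x i ∈ Metric.ball a r → x i = u) := by
    intro i
    by_cases hi : x i ∈ Metric.ball a r
    · exact ⟨x i, fun his => (hxmin i his).isLocalMin <| mem_of_superset
        (Metric.isOpen_ball.mem_nhds hi) Metric.ball_subset_closedBall, fun _ _ => rfl⟩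
    · by_cases his : i ∈ s
      · obtain ⟨u, hu⟩ := (hlsc i his).exists_isLocalMin_add_norm_sub_sq (hb i his) a
        exact ⟨u, fun _ => hu, fun _ h => absurd h hi⟩
      · exact ⟨a, fun h => absurd h his, fun h => absurd h his⟩
  choose u hu hxu using hglue
  refine ⟨u, hu, hxlim.congr' ?_⟩
  filter_upwards [hs, hxlim (Metric.ball_mem_nhds a hr)] with i hi hxi using hxu i hi hxi

end GammaLiminf

/-! ### Monotone equations and variational inequalities -/

section StronglyMonotone

variable {H : Type*} [NormedAddCommGroup H] [InnerProductSpace ℝ H]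

lemma norm_sub_smul_sq_le {x y : H} {c K t : ℝ} (ht : 0 ≤ t) (hy : ‖y‖ ≤ K * ‖x‖)
    (hxy : c * ‖x‖ ^ 2 ≤ ⟪y, x⟫) : ‖x - t • y‖ ^ 2 ≤ (1 - 2 * t * c + (t * K) ^ 2) * ‖x‖ ^ 2 := by
  have hy' : ‖y‖ ^ 2 ≤ (K * ‖x‖) ^ 2 := pow_le_pow_left₀ (norm_nonneg y) hy 2
  calc ‖x - t • y‖ ^ 2 = ‖x‖ ^ 2 - 2 * t * ⟪y, x⟫ + t ^ 2 * ‖y‖ ^ 2 := by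
        rw [norm_sub_sq_real, real_inner_smul_right, norm_smul, mul_pow, Real.norm_eq_abs, sq_abs,
          real_inner_comm]
        ring
    _ ≤ ‖x‖ ^ 2 - 2 * t * (c * ‖x‖ ^ 2) + t ^ 2 * (K * ‖x‖) ^ 2 := by gcongr
    _ = (1 - 2 * t * c + (t * K) ^ 2) * ‖x‖ ^ 2 := by ring

/-- A solution of `A x = b` is a fixed point of `x ↦ x - t • (A x - b)`, which is a contraction for
small `t > 0`. -/
theorem surjective_of_stronglyMonotone [CompleteSpace H] {A : H → H} {c : ℝ} {K : ℝ≥0} (hc : 0 < c)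
    (hA : LipschitzWith K A) (hmono : ∀ x y, c * ‖x - y‖ ^ 2 ≤ ⟪A x - A y, x - y⟫) :
    Function.Surjective A := by
  intro b
  set M : ℝ := K + c
  have hM : 0 < M := add_pos_of_nonneg_of_pos K.2 hc
  set t : ℝ := c / M ^ 2
  have ht : 0 < t := by positivity
  have htK : (t * K) ^ 2 ≤ t * c := by
    calc (t * K) ^ 2 ≤ (t * M) ^ 2 := by gcongr; exact le_add_of_nonneg_right hc.le
      _ = t * c := by simp only [t]; field_simp
  have hcontr : ContractingWith (Real.toNNReal √(1 - t * c)) fun x => x - t • (A x - b) := by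
    refine ⟨?_, LipschitzWith.of_dist_le_mul fun x y => ?_⟩
    · rw [← NNReal.coe_lt_one, Real.coe_toNNReal _ (Real.sqrt_nonneg _), Real.sqrt_lt' one_pos]
      linarith [mul_pos ht hc]
    rw [Real.coe_toNNReal _ (Real.sqrt_nonneg _), dist_eq_norm, dist_eq_norm,
      show x - t • (A x - b) - (y - t • (A y - b)) = (x - y) - t • (A x - A y) by module,
      ← Real.sqrt_sq (norm_nonneg (x - y)), ← Real.sqrt_mul' _ (sq_nonneg _)]
    refine Real.le_sqrt_of_sq_le ((norm_sub_smul_sq_le ht.le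
      (by simpa only [dist_eq_norm] using hA.dist_le_mul x y) (hmono x y)).trans ?_)
    gcongr
    linarith
  have hfix := hcontr.fixedPoint_isFixedPt
  rw [Function.IsFixedPt, sub_eq_self, smul_eq_zero_iff_right ht.ne', sub_eq_zero] at hfix
  exact ⟨_, hfix⟩

end StronglyMonotone

section VariationalInequality

variable {V W L : Type*} [NormedAddCommGroup V] [InnerProductSpace ℝ V]
  [NormedAddCommGroup W] [InnerProductSpace ℝ W] [NormedAddCommGroup L] [InnerProductSpace ℝ L]

/-- The weak formulation of `G*G y + T* B(T y) = T* u`, where `G` plays the role of the gradient,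
`T` that of the embedding of the state space into the control space and `B` is a nonlinearity. -/
def SolvesEquation (G : V →L[ℝ] W) (T : V →L[ℝ] L) (B : L → L) (u : L) (y : V) : Prop :=
  ∀ v, ⟪G y, G v⟫ + ⟪B (T y), T v⟫ = ⟪u, T v⟫

/-- The variational inequality of the second kind for the functional `j`, up to the slack `δ`; the
exact inequality is the case `δ = 0`. -/
def SolvesApproxVI (G : V →L[ℝ] W) (T : V →L[ℝ] L) (j : L → ℝ) (δ : ℝ) (u : L) (y : V) : Prop :=
  ∀ v, ⟪u, T (v - y)⟫ ≤ ⟪G y, G (v - y)⟫ + j (T v) - j (T y) + δ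

variable {G : V →L[ℝ] W} {T : V →L[ℝ] L} {B : L → L} {j : L → ℝ} {δ δ' : ℝ} {u u' : L} {y z : V}
  {K : ℝ≥0}

lemma SolvesEquation.solvesApproxVI (h : SolvesEquation G T B u y)
    (hB : ∀ s t, ⟪B s, t - s⟫ ≤ j t - j s + δ) : SolvesApproxVI G T j δ u y := fun v => by
  have hBv := hB (T y) (T v)
  rw [← map_sub] at hBv
  linarith [h (v - y)]

lemma norm_sq_le_of_monotone (G : V →L[ℝ] W) (T : V →L[ℝ] L)
    (hB : ∀ s t, 0 ≤ ⟪B s - B t, s - t⟫) (y z : V) :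
    ‖G (y - z)‖ ^ 2 ≤ ⟪G y, G (y - z)⟫ + ⟪B (T y), T (y - z)⟫ -
      (⟪G z, G (y - z)⟫ + ⟪B (T z), T (y - z)⟫) := by
  have hBv := hB (T y) (T z)
  rw [← map_sub, inner_sub_left] at hBv
  have hG : ‖G (y - z)‖ ^ 2 = ⟪G y, G (y - z)⟫ - ⟪G z, G (y - z)⟫ := by
    rw [← real_inner_self_eq_norm_sq, ← inner_sub_left, ← map_sub]
  linarith

lemma SolvesEquation.norm_sq_le (h : SolvesEquation G T B u y) (h' : SolvesEquation G T B u' z)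
    (hB : ∀ s t, 0 ≤ ⟪B s - B t, s - t⟫) : ‖G (y - z)‖ ^ 2 ≤ ⟪u - u', T (y - z)⟫ := by
  rw [inner_sub_left, ← h, ← h']
  exact norm_sq_le_of_monotone G T hB y z

lemma SolvesApproxVI.norm_sq_le (h : SolvesApproxVI G T j δ u y)
    (h' : SolvesApproxVI G T j δ' u' z) :
    ‖G (y - z)‖ ^ 2 ≤ ⟪u - u', T (y - z)⟫ + (δ + δ') := by
  have h₁ := h z
  rw [← neg_sub y z, map_neg, map_neg, inner_neg_right, inner_neg_right] at h₁
  rw [inner_sub_left, ← real_inner_self_eq_norm_sq]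
  nth_rw 1 [map_sub]
  rw [inner_sub_left]
  linarith [h' y]

lemma norm_sq_le_of_antilipschitz (hG : AntilipschitzWith K G) (y : V) :
    ‖y‖ ^ 2 ≤ K ^ 2 * ‖G y‖ ^ 2 := by
  rw [← mul_pow]
  exact pow_le_pow_left₀ (norm_nonneg y) (G.bound_of_antilipschitz hG y) 2

lemma eq_of_norm_sq_nonpos (hG : AntilipschitzWith K G) (h : ‖G (y - z)‖ ^ 2 ≤ 0) : y = z := by
  have hzero : G (y - z) = 0 := by simpa using h.antisymm (sq_nonneg _)
  exact hG.injective (sub_eq_zero.1 (by rw [← map_sub, hzero]))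

/-- Complete continuity of `T` passes to its adjoint, so `‖T* (u n - u₀)‖ → 0`, and
`⟪u n - u₀, T (y n - z)⟫ ≤ ‖T* (u n - u₀)‖ * ‖y n - z‖` can be absorbed. -/
theorem tendsto_of_norm_sq_le [CompleteSpace V] [CompleteSpace L] (hG : AntilipschitzWith K G)
    (hT : IsCompletelyContinuous T) {y : ℕ → V} {u : ℕ → L} {δ : ℕ → ℝ} {u₀ : L}
    (hu : WeakTendsto u atTop u₀) (hδ : Tendsto δ atTop (𝓝 0))
    (hy : ∀ᶠ n in atTop, ‖G (y n - z)‖ ^ 2 ≤ ⟪u n - u₀, T (y n - z)⟫ + δ n) :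
    Tendsto y atTop (𝓝 z) := by
  have hbound : ∀ᶠ n in atTop, ‖y n - z‖ ^ 2 ≤
      K ^ 4 * ‖T.adjoint (u n) - T.adjoint u₀‖ ^ 2 + 2 * K ^ 2 * δ n := by
    filter_upwards [hy] with n hn
    set a := ‖T.adjoint (u n) - T.adjoint u₀‖
    have ha : ⟪u n - u₀, T (y n - z)⟫ ≤ a * ‖y n - z‖ := by
      rw [← ContinuousLinearMap.adjoint_inner_left, map_sub]
      exact real_inner_le_norm _ _
    have hd : ‖y n - z‖ ^ 2 ≤ K ^ 2 * (a * ‖y n - z‖ + δ n) :=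
      (norm_sq_le_of_antilipschitz hG _).trans (by gcongr; linarith)
    linarith [two_mul_le_add_sq (K ^ 2 * a) ‖y n - z‖]
  have ha : Tendsto (fun n => ‖T.adjoint (u n) - T.adjoint u₀‖) atTop (𝓝 0) :=
    tendsto_iff_norm_sub_tendsto_zero.1 (hT.adjoint hu)
  refine tendsto_of_norm_sub_sq_tendsto_zero
    (squeeze_zero' (.of_forall fun n => sq_nonneg _) hbound ?_)
  simpa using ((ha.pow 2).const_mul ((K : ℝ) ^ 4)).add (hδ.const_mul (2 * (K : ℝ) ^ 2))

theorem existsUnique_solvesEquation [CompleteSpace V] [CompleteSpace W] [CompleteSpace L]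
    {M : ℝ≥0} (hG : AntilipschitzWith K G) (hB : LipschitzWith M B)
    (hmono : ∀ s t, 0 ≤ ⟪B s - B t, s - t⟫) (T : V →L[ℝ] L) (u : L) :
    ∃! y, SolvesEquation G T B u y := by
  set A : V → V := fun y => G.adjoint (G y) + T.adjoint (B (T y))
  have hA : LipschitzWith _ A :=
    (G.adjoint.lipschitz.comp G.lipschitz).add (T.adjoint.lipschitz.comp (hB.comp T.lipschitz))
  have hinner : ∀ y v, ⟪A y, v⟫ = ⟪G y, G v⟫ + ⟪B (T y), T v⟫ := fun y v => by
    simp only [A, inner_add_left, ContinuousLinearMap.adjoint_inner_left]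
  have hAmono : ∀ y z, ((K : ℝ) ^ 2 + 1)⁻¹ * ‖y - z‖ ^ 2 ≤ ⟪A y - A z, y - z⟫ := by
    intro y z
    rw [inner_sub_left, hinner, hinner, inv_mul_le_iff₀ (by positivity)]
    calc ‖y - z‖ ^ 2 ≤ K ^ 2 * ‖G (y - z)‖ ^ 2 := norm_sq_le_of_antilipschitz hG _
      _ ≤ (K ^ 2 + 1) * ‖G (y - z)‖ ^ 2 := by gcongr; linarith
      _ ≤ _ := by gcongr; exact norm_sq_le_of_monotone G T hmono y z
  obtain ⟨y, hy⟩ := surjective_of_stronglyMonotone (by positivity) hA hAmono (T.adjoint u)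
  have hsol : SolvesEquation G T B u y := fun v => by
    rw [← hinner, hy, ContinuousLinearMap.adjoint_inner_left]
  exact ⟨y, hsol, fun z hz =>
    eq_of_norm_sq_nonpos hG (by simpa using hz.norm_sq_le hsol hmono)⟩

lemma SolvesApproxVI.of_tendsto {y : ℕ → V} {δ : ℕ → ℝ} {δ₀ : ℝ} (hj : Continuous j)
    (h : ∀ n, SolvesApproxVI G T j (δ n) u (y n)) (hy : Tendsto y atTop (𝓝 z))
    (hδ : Tendsto δ atTop (𝓝 δ₀)) : SolvesApproxVI G T j δ₀ u z := fun v => by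
  have hv : Tendsto (fun n => v - y n) atTop (𝓝 (v - z)) := tendsto_const_nhds.sub hy
  have hGy := (G.continuous.tendsto z).comp hy
  have hTy := ((hj.comp T.continuous).tendsto z).comp hy
  exact le_of_tendsto_of_tendsto' (tendsto_const_nhds.inner ((T.continuous.tendsto _).comp hv))
    ((((hGy.inner ((G.continuous.tendsto _).comp hv)).add_const _).sub hTy).add hδ) fun n => h n v

theorem existsUnique_solvesApproxVI_zero [CompleteSpace V] (hG : AntilipschitzWith K G)
    (hj : Continuous j) (happrox : ∀ δ > 0, ∃ y, SolvesApproxVI G T j δ u y) :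
    ∃! y, SolvesApproxVI G T j 0 u y := by
  choose y hy using fun n : ℕ => happrox (1 / ((n : ℝ) + 1)) (by positivity)
  have hδ : Tendsto (fun n : ℕ => 1 / ((n : ℝ) + 1)) atTop (𝓝 0) :=
    tendsto_one_div_add_atTop_nhds_zero_nat
  have hroot : Tendsto (fun n : ℕ => √(K ^ 2 * (2 * (1 / ((n : ℝ) + 1))))) atTop (𝓝 0) := by
    simpa only [mul_zero, Real.sqrt_zero] using ((hδ.const_mul 2).const_mul ((K : ℝ) ^ 2)).sqrt
  have hcauchy : CauchySeq y := by
    refine cauchySeq_of_le_tendsto_0' (fun n => √(K ^ 2 * (2 * (1 / ((n : ℝ) + 1)))))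
      (fun n m hnm => ?_) hroot
    rw [dist_eq_norm]
    refine Real.le_sqrt_of_sq_le ((norm_sq_le_of_antilipschitz hG _).trans ?_)
    have hslack : 1 / ((m : ℝ) + 1) ≤ 1 / ((n : ℝ) + 1) := by gcongr
    gcongr
    calc ‖G (y n - y m)‖ ^ 2 ≤ 1 / ((n : ℝ) + 1) + 1 / ((m : ℝ) + 1) := by
          simpa using (hy n).norm_sq_le (hy m)
      _ ≤ 2 * (1 / ((n : ℝ) + 1)) := by linarith
  obtain ⟨z, hz⟩ := cauchySeq_tendsto_of_complete hcauchy
  have hsol := SolvesApproxVI.of_tendsto hj hy hz hδ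
  exact ⟨z, hsol, fun w hw => eq_of_norm_sq_nonpos hG (by simpa using hw.norm_sq_le hsol)⟩

end VariationalInequality

section WeakStrong

variable {V L ι : Type*} [NormedAddCommGroup V] [NormedAddCommGroup L] [InnerProductSpace ℝ L]
  {l : Filter ι} {S : ι → L → V} {S₀ : L → V}

/-- Continuous convergence of the maps `S i` to `S₀` along `l` for the weak topology on `L` and the
norm topology on `V`: `S (k n) (u n) → S₀ a` whenever `k n` tends to `l` and `u n` tends weakly to
`a`. For a constant family this is complete continuity. -/
def WeakStrongTendsto (S : ι → L → V) (l : Filter ι) (S₀ : L → V) : Prop :=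
  ∀ ⦃k : ℕ → ι⦄, Tendsto k atTop l → ∀ ⦃u : ℕ → L⦄ ⦃a : L⦄, WeakTendsto u atTop a →
    Tendsto (fun n => S (k n) (u n)) atTop (𝓝 (S₀ a))

lemma WeakStrongTendsto.tendsto_apply [l.IsCountablyGenerated] (h : WeakStrongTendsto S l S₀)
    (a : L) : Tendsto (fun i => S i a) l (𝓝 (S₀ a)) :=
  tendsto_of_seq_tendsto fun _ hk => h hk (weakTendsto_const a)

lemma WeakStrongTendsto.isWeakGammaLowerBound (h : WeakStrongTendsto S l S₀) {Φ : V → ℝ}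
    (hΦ : Continuous Φ) {c : ℝ} (hc : 0 ≤ c) (b : L) :
    IsWeakGammaLowerBound (fun i u => Φ (S i u) + c * ‖u - b‖ ^ 2) l
      fun u => Φ (S₀ u) + c * ‖u - b‖ ^ 2 :=
  (IsWeakGammaLowerBound.of_tendsto fun _ hk _ _ hu => (hΦ.tendsto _).comp (h hk hu)).add
    (isWeakGammaLowerBound_mul_norm_sub_sq hc b)

theorem WeakStrongTendsto.exists_isLocalMin_tendsto [CompleteSpace L] [SeparableSpace L]
    [l.IsCountablyGenerated] {s : Set ι} (hs : s ∈ l)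
    (hS : ∀ i ∈ s, WeakStrongTendsto (fun _ : Unit => S i) ⊤ (S i)) (h : WeakStrongTendsto S l S₀)
    {Φ : V → ℝ} (hΦ : Continuous Φ) (hΦ₀ : ∀ y, 0 ≤ Φ y) {c : ℝ} (hc : 0 ≤ c) {a b : L}
    (ha : IsLocalMin (fun u => Φ (S₀ u) + c * ‖u - b‖ ^ 2) a) :
    ∃ u : ι → L, (∀ i ∈ s, IsLocalMin
      (fun u => Φ (S i u) + c * ‖u - b‖ ^ 2 + ‖u - a‖ ^ 2) (u i)) ∧ Tendsto u l (𝓝 a) :=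
  VIControl.exists_isLocalMin_tendsto hs
    (fun i hi => (hS i hi).isWeakGammaLowerBound hΦ hc b)
    (fun i _ u => add_nonneg (hΦ₀ (S i u)) (by positivity)) (h.isWeakGammaLowerBound hΦ hc b)
    (((hΦ.tendsto _).comp (h.tendsto_apply a)).add_const _) ha

end WeakStrong

section SolutionOperator

/-- The map from right-hand sides `u` to solutions `y` of `A u y`; its value is arbitrary where
`A u` has no solution. -/
def solutionOperator {V L : Type*} [Nonempty V] (A : L → V → Prop) (u : L) : V :=
  Classical.epsilon (A u)

lemma solutionOperator_spec {V L : Type*} [Nonempty V] {A : L → V → Prop} {u : L}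
    (h : ∃ y, A u y) : A u (solutionOperator A u) :=
  Classical.epsilon_spec h

lemma iff_eq_solutionOperator {V L : Type*} [Nonempty V] {A : L → V → Prop} {u : L}
    (h : ∃! y, A u y) (y : V) : A u y ↔ y = solutionOperator A u :=
  ⟨fun hy => h.unique hy (solutionOperator_spec h.exists), fun hy =>
    hy ▸ solutionOperator_spec h.exists⟩

variable {V W L ι : Type*} [NormedAddCommGroup V] [InnerProductSpace ℝ V] [CompleteSpace V]
  [NormedAddCommGroup W] [InnerProductSpace ℝ W]
  [NormedAddCommGroup L] [InnerProductSpace ℝ L] [CompleteSpace L]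
  {G : V →L[ℝ] W} {T : V →L[ℝ] L} {K : ℝ≥0}

lemma weakStrongTendsto_of_solvesEquation (hG : AntilipschitzWith K G)
    (hT : IsCompletelyContinuous T) {B : L → L} (hB : ∀ s t, 0 ≤ ⟪B s - B t, s - t⟫) {S : L → V}
    (hS : ∀ u, SolvesEquation G T B u (S u)) : WeakStrongTendsto (fun _ : Unit => S) ⊤ S :=
  fun _ _ u a hu => tendsto_of_norm_sq_le hG hT hu tendsto_const_nhds <| .of_forall fun n => by
    simpa using (hS (u n)).norm_sq_le (hS a) hB

lemma weakStrongTendsto_of_solvesApproxVI (hG : AntilipschitzWith K G)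
    (hT : IsCompletelyContinuous T) {j : L → ℝ} {l : Filter ι} {δ : ι → ℝ}
    (hδ : Tendsto δ l (𝓝 0)) {S : ι → L → V} {S₀ : L → V}
    (hS : ∀ᶠ i in l, ∀ u, SolvesApproxVI G T j (δ i) u (S i u))
    (hS₀ : ∀ u, SolvesApproxVI G T j 0 u (S₀ u)) : WeakStrongTendsto S l S₀ :=
  fun _ hk u a hu => tendsto_of_norm_sq_le hG hT hu (hδ.comp hk) <|
    (hk.eventually hS).mono fun n hn => by simpa using (hn (u n)).norm_sq_le (hS₀ a)

end SolutionOperator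

/-! ### Ball averages and the embedding of `H₀¹(Ω)` -/

section LpDifference

open Set

lemma lintegral_rpow_le_lintegral_rpow {S : Type*} [MeasurableSpace S] {ρ : Measure S}
    [IsProbabilityMeasure ρ] {g : S → ℝ≥0∞} (hg : AEMeasurable g ρ) {q : ℝ} (hq : 1 ≤ q) :
    (∫⁻ s, g s ∂ρ) ^ q ≤ ∫⁻ s, g s ^ q ∂ρ := by
  have h := eLpNorm'_le_eLpNorm'_of_exponent_le one_pos hq ρ hg.aestronglyMeasurable
  simp only [eLpNorm'_eq_lintegral_enorm, enorm_eq_self, ENNReal.rpow_one, div_one] at h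
  rwa [one_div, ENNReal.le_rpow_inv_iff (by positivity)] at h

lemma eLpNorm_le_of_enorm_le_lintegral {X S F : Type*} [MeasurableSpace X] [MeasurableSpace S]
    [NormedAddCommGroup F] {μ : Measure X} [SFinite μ] {ρ : Measure S} [IsProbabilityMeasure ρ]
    {f : X → F} {g : X → S → ℝ≥0∞} (hg : Measurable (Function.uncurry g)) {p : ℝ≥0∞}
    (hp : 1 ≤ p) (hp' : p ≠ ⊤) {C : ℝ≥0∞} (hfg : ∀ x, ‖f x‖ₑ ≤ ∫⁻ s, g x s ∂ρ)
    (hC : ∀ᵐ s ∂ρ, eLpNorm (fun x => g x s) p μ ≤ C) : eLpNorm f p μ ≤ C := by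
  have hp₀ : p ≠ 0 := (one_pos.trans_le hp).ne'
  have hq : 1 ≤ p.toReal := ENNReal.toReal_mono hp' hp
  simp only [eLpNorm_eq_lintegral_rpow_enorm_toReal hp₀ hp', one_div,
    ENNReal.rpow_inv_le_iff (one_pos.trans_le hq), enorm_eq_self] at hC ⊢
  calc ∫⁻ x, ‖f x‖ₑ ^ p.toReal ∂μ
      ≤ ∫⁻ x, ∫⁻ s, g x s ^ p.toReal ∂ρ ∂μ := lintegral_mono fun x =>
        (ENNReal.rpow_le_rpow (hfg x) (by positivity)).trans
          (lintegral_rpow_le_lintegral_rpow (hg.comp measurable_prodMk_left).aemeasurable hq)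
    _ = ∫⁻ s, ∫⁻ x, g x s ^ p.toReal ∂μ ∂ρ :=
        lintegral_lintegral_swap (hg.pow_const _).aemeasurable
    _ ≤ ∫⁻ _, C ^ p.toReal ∂ρ := lintegral_mono_ae hC
    _ = C ^ p.toReal := by simp

lemma enorm_add_sub_le_lintegral_fderiv {E F : Type*} [NormedAddCommGroup E] [NormedSpace ℝ E]
    [NormedAddCommGroup F] [NormedSpace ℝ F] {f : E → F} (hf : ContDiff ℝ 1 f) (x h : E) :
    ‖f (x + h) - f x‖ₑ ≤ ∫⁻ s in Icc (0 : ℝ) 1, ‖h‖ₑ * ‖fderiv ℝ f (x + s • h)‖ₑ := by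
  have hline : ContDiff ℝ 1 fun s : ℝ => f (x + s • h) := by fun_prop
  have hderiv (s : ℝ) : deriv (fun s : ℝ => f (x + s • h)) s = fderiv ℝ f (x + s • h) h := by
    have hfs := (hf.differentiable one_ne_zero (x + s • h)).hasFDerivAt
    have := ((hasDerivAt_id s).smul_const h).const_add x
    simpa [Function.comp_def] using (hfs.comp_hasDerivAt s this).deriv
  calc ‖f (x + h) - f x‖ₑ
      ≤ ∫⁻ s in Icc (0 : ℝ) 1, ‖fderiv ℝ f (x + s • h) h‖ₑ := by
        simpa [hderiv] using
          enorm_sub_le_lintegral_deriv_of_contDiffOn_Icc hline.contDiffOn zero_le_one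
    _ ≤ _ := by
        refine lintegral_mono fun s => ?_
        rw [mul_comm]
        exact ContinuousLinearMap.le_opENorm _ _

variable {E F : Type*} [NormedAddCommGroup E] [NormedSpace ℝ E] [MeasurableSpace E] [BorelSpace E]
  [SecondCountableTopology E] [NormedAddCommGroup F] [NormedSpace ℝ F] {f : E → F}
  {p : ℝ≥0∞} {μ : Measure E} [SFinite μ] [μ.IsAddRightInvariant]

lemma eLpNorm_add_sub_le (hf : ContDiff ℝ 1 f) (hp : 1 ≤ p) (hp' : p ≠ ⊤) (h : E) :
    eLpNorm (fun x => f (x + h) - f x) p μ ≤ ‖h‖ₑ * eLpNorm (fderiv ℝ f) p μ := by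
  have hf' : Continuous (fderiv ℝ f) := hf.continuous_fderiv one_ne_zero
  have : IsProbabilityMeasure (volume.restrict (Icc (0 : ℝ) 1)) := ⟨by simp⟩
  refine eLpNorm_le_of_enorm_le_lintegral (Measurable.const_mul ?_ _) hp hp'
    (enorm_add_sub_le_lintegral_fderiv hf · h) (.of_forall fun s => ?_)
  · exact (by fun_prop : Continuous fun q : E × ℝ => ‖fderiv ℝ f (q.1 + q.2 • h)‖ₑ).measurable
  · calc eLpNorm (fun x => ‖h‖ₑ * ‖fderiv ℝ f (x + s • h)‖ₑ) p μ
        ≤ ‖h‖₊ • eLpNorm (fun x => fderiv ℝ f (x + s • h)) p μ :=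
          eLpNorm_le_nnreal_smul_eLpNorm_of_ae_le_mul' (.of_forall fun _ => le_rfl) p
      _ = ‖h‖ₑ * eLpNorm (fderiv ℝ f) p μ := by
          rw [ENNReal.smul_def, smul_eq_mul, enorm_eq_nnnorm]
          exact congrArg _ <| eLpNorm_comp_measurePreserving hf'.aestronglyMeasurable
            (measurePreserving_add_right μ (s • h))

lemma eLpNorm_sub_integral_add_le [CompleteSpace F] (hf : ContDiff ℝ 1 f) (hp : 1 ≤ p)
    (hp' : p ≠ ⊤) {ρ : Measure E} [IsProbabilityMeasure ρ]
    (hint : ∀ x, Integrable (fun t => f (x + t)) ρ) {r : ℝ} (hr : ∀ᵐ t ∂ρ, ‖t‖ ≤ r) :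
    eLpNorm (fun x => f x - ∫ t, f (x + t) ∂ρ) p μ
      ≤ ENNReal.ofReal r * eLpNorm (fderiv ℝ f) p μ := by
  have hcont : Continuous fun q : E × E => ‖f (q.1 + q.2) - f q.1‖ₑ := by fun_prop
  refine eLpNorm_le_of_enorm_le_lintegral (ρ := ρ) (g := fun x t => ‖f (x + t) - f x‖ₑ)
    hcont.measurable hp hp' (fun x => ?_) ?_
  · calc ‖f x - ∫ t, f (x + t) ∂ρ‖ₑ = ‖∫ t, (f (x + t) - f x) ∂ρ‖ₑ := by
          rw [integral_sub (hint x) (integrable_const _), integral_const, probReal_univ, one_smul,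
            ← enorm_neg, neg_sub]
      _ ≤ ∫⁻ t, ‖f (x + t) - f x‖ₑ ∂ρ := enorm_integral_le_lintegral_enorm _
  · filter_upwards [hr] with t ht
    rw [eLpNorm_enorm]
    refine (eLpNorm_add_sub_le hf hp hp' t).trans ?_
    gcongr
    rw [← ofReal_norm]
    exact ENNReal.ofReal_le_ofReal ht

end LpDifference

section BoundedKernel

variable {X H : Type*} [MeasurableSpace X] {μ : Measure X} [IsFiniteMeasure μ]
  [NormedAddCommGroup H] [InnerProductSpace ℝ H] {κ : X → H} {C : ℝ}

lemma memLp_inner_kernel (hκ : ∀ f, StronglyMeasurable fun x => ⟪κ x, f⟫) (hC : ∀ x, ‖κ x‖ ≤ C)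
    (f : H) : MemLp (fun x => ⟪κ x, f⟫) 2 μ :=
  .of_bound (hκ f).aestronglyMeasurable (C * ‖f‖) <| .of_forall fun x =>
    (norm_inner_le_norm _ _).trans (by gcongr; exact hC x)

lemma norm_toLp_inner_kernel_le (hκ : ∀ f, StronglyMeasurable fun x => ⟪κ x, f⟫)
    (hC : ∀ x, ‖κ x‖ ≤ C) (f : H) : ‖(memLp_inner_kernel hκ hC f).toLp (μ := μ)‖
      ≤ μ.real Set.univ ^ (1 / 2 : ℝ) * C * ‖f‖ := by
  rcases isEmpty_or_nonempty X with _ | ⟨⟨x⟩⟩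
  · simp [Measure.eq_zero_of_isEmpty μ]
  have hC₀ : 0 ≤ C := (norm_nonneg _).trans (hC x)
  have h := Lp.norm_le_of_ae_bound (mul_nonneg hC₀ (norm_nonneg f)) <|
    (memLp_inner_kernel (μ := μ) hκ hC f).coeFn_toLp.mono fun x hx => by
      rw [hx]
      exact (norm_inner_le_norm _ _).trans (mul_le_mul_of_nonneg_right (hC x) (norm_nonneg f))
  rw [mul_assoc]
  simpa [measureUnivNNReal, Measure.real, ENNReal.coe_toNNReal_eq_toReal] using h

/-- The integral operator `f ↦ (x ↦ ⟪κ x, f⟫)` from a Hilbert space to `L²(μ)`, for a bounded,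
weakly measurable kernel `κ` and a finite measure `μ`. -/
def kernelOperator (μ : Measure X) [IsFiniteMeasure μ]
    (hκ : ∀ f, StronglyMeasurable fun x => ⟪κ x, f⟫) (hC : ∀ x, ‖κ x‖ ≤ C) : H →L[ℝ] Lp ℝ 2 μ :=
  LinearMap.mkContinuous
    { toFun f := (memLp_inner_kernel hκ hC f).toLp
      map_add' f g := by
        simp_rw [inner_add_right]
        exact MemLp.toLp_add (memLp_inner_kernel hκ hC f) (memLp_inner_kernel hκ hC g)
      map_smul' c f := by
        simp_rw [real_inner_smul_right]
        exact MemLp.toLp_const_smul c (memLp_inner_kernel hκ hC f) }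
    (μ.real Set.univ ^ (1 / 2 : ℝ) * C) (norm_toLp_inner_kernel_le hκ hC)

variable (hκ : ∀ f, StronglyMeasurable fun x => ⟪κ x, f⟫) (hC : ∀ x, ‖κ x‖ ≤ C)

lemma coeFn_kernelOperator (f : H) : kernelOperator μ hκ hC f =ᵐ[μ] fun x => ⟪κ x, f⟫ :=
  (memLp_inner_kernel hκ hC f).coeFn_toLp

lemma norm_kernelOperator_apply_le (f : H) :
    ‖kernelOperator μ hκ hC f‖ ≤ μ.real Set.univ ^ (1 / 2 : ℝ) * C * ‖f‖ :=
  norm_toLp_inner_kernel_le hκ hC f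

lemma norm_kernelOperator_apply_sq (f : H) :
    ‖kernelOperator μ hκ hC f‖ ^ 2 = ∫ x, ⟪κ x, f⟫ ^ 2 ∂μ := by
  rw [← real_inner_self_eq_norm_sq, L2.inner_def]
  refine integral_congr_ae ((coeFn_kernelOperator hκ hC f).mono fun x hx => ?_)
  simp only [hx, real_inner_self_eq_norm_sq, Real.norm_eq_abs, sq_abs]

lemma isCompletelyContinuous_kernelOperator [CompleteSpace H] :
    IsCompletelyContinuous (kernelOperator μ hκ hC) := by
  intro f g hf
  have hfg : WeakTendsto (fun n => f n - g) atTop 0 := by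
    simpa only [sub_self] using hf.sub (weakTendsto_const g)
  obtain ⟨M, hM⟩ := hfg.exists_norm_le
  refine tendsto_of_norm_sub_sq_tendsto_zero ?_
  simp_rw [← map_sub, norm_kernelOperator_apply_sq]
  rw [← integral_zero X ℝ (μ := μ)]
  refine tendsto_integral_of_dominated_convergence (fun _ => (C * M) ^ 2)
    (fun n => ((hκ _).pow 2).aestronglyMeasurable) (integrable_const _)
    (fun n => .of_forall fun x => ?_) (.of_forall fun x => ?_)
  · rw [norm_pow]
    gcongr
    exact (norm_inner_le_norm _ _).trans (mul_le_mul (hC x) (hM n) (norm_nonneg _)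
      ((norm_nonneg _).trans (hC x)))
  · simpa [real_inner_comm] using (hfg (κ x)).pow 2

end BoundedKernel

section BallIntegral

variable {X : Type*} [PseudoMetricSpace X] [MeasurableSpace X] [OpensMeasurableSpace X]
  {μ : Measure X} [IsFiniteMeasure μ]

/-- The indicator function of the ball `B(x, r)` as an element of `L²(μ)`. -/
def ballIndicator (μ : Measure X) [IsFiniteMeasure μ] (r : ℝ) (x : X) : Lp ℝ 2 μ :=
  indicatorConstLp 2 (measurableSet_ball (x := x) (ε := r)) (measure_ne_top μ _) 1

lemma inner_ballIndicator (r : ℝ) (x : X) (f : Lp ℝ 2 μ) :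
    ⟪ballIndicator μ r x, f⟫ = ∫ y in Metric.ball x r, f y ∂μ :=
  L2.inner_indicatorConstLp_one _ _ _

lemma norm_ballIndicator_le (r : ℝ) (x : X) :
    ‖ballIndicator μ r x‖ ≤ μ.real Set.univ ^ (1 / 2 : ℝ) := by
  rw [ballIndicator, norm_indicatorConstLp (by simp) (by simp), norm_one, one_mul,
    ENNReal.toReal_ofNat]
  exact Real.rpow_le_rpow measureReal_nonneg (measureReal_mono (Set.subset_univ _)) (by norm_num)

variable [SecondCountableTopology X]

lemma stronglyMeasurable_inner_ballIndicator (r : ℝ) (f : Lp ℝ 2 μ) :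
    StronglyMeasurable fun x => ⟪ballIndicator μ r x, f⟫ := by
  have hs : MeasurableSet {p : X × X | dist p.2 p.1 < r} :=
    (isOpen_lt (by fun_prop) continuous_const).measurableSet
  simp_rw [inner_ballIndicator, ← integral_indicator measurableSet_ball]
  exact (((Lp.stronglyMeasurable f).comp_measurable
    measurable_snd).indicator hs).integral_prod_right'

/-- The operator on `L²(μ)` that sends `f` to `x ↦ ∫_{B(x, r)} f dμ`. Divided by the volume of the
ball it is the averaging operator in the proofs of the Poincaré and the Rellich theorem. -/
def ballIntegral (μ : Measure X) [IsFiniteMeasure μ] (r : ℝ) : Lp ℝ 2 μ →L[ℝ] Lp ℝ 2 μ :=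
  kernelOperator μ (stronglyMeasurable_inner_ballIndicator (μ := μ) r) (norm_ballIndicator_le r)

lemma coeFn_ballIntegral (r : ℝ) (f : Lp ℝ 2 μ) :
    ballIntegral μ r f =ᵐ[μ] fun x => ∫ y in Metric.ball x r, f y ∂μ :=
  (coeFn_kernelOperator _ _ f).trans (.of_eq (funext (inner_ballIndicator r · f)))

lemma isCompletelyContinuous_ballIntegral (r : ℝ) : IsCompletelyContinuous (ballIntegral μ r) :=
  isCompletelyContinuous_kernelOperator _ _

lemma norm_ballIntegral_apply_le (r : ℝ) (f : Lp ℝ 2 μ) :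
    ‖ballIntegral μ r f‖ ≤ μ.real Set.univ * ‖f‖ := by
  have h := norm_kernelOperator_apply_le (μ := μ) (stronglyMeasurable_inner_ballIndicator r)
    (norm_ballIndicator_le r) f
  rwa [← Real.rpow_add' measureReal_nonneg (by norm_num), add_halves, Real.rpow_one] at h

end BallIntegral

section Sobolev

variable {d : ℕ} {Ω : Opens (Space d)}

lemma inner_integral_smul_gradient (y : L2 Ω) (φ : 𝓓(Ω, ℝ)) (e : Space d)
    (h : MemLp (fun x => ⟪e, ∇ φ x⟫) 2 (volume.restrict (Ω : Set (Space d)))) :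
    ⟪e, ∫ x in (Ω : Set (Space d)), y x • ∇ φ x⟫ = ⟪y, h.toLp⟫ := by
  rw [← integral_inner (integrable_smul_gradient y φ), L2.inner_def]
  refine integral_congr_ae (h.coeFn_toLp.mono fun x hx => ?_)
  beta_reduce
  rw [hx, inner_smul_right]
  exact mul_comm _ _

lemma inner_integral_test_smul (g : L2Vec Ω) (φ : 𝓓(Ω, ℝ)) (e : Space d)
    (h : MemLp (fun x => φ x • e) 2 (volume.restrict (Ω : Set (Space d)))) :
    ⟪e, ∫ x in (Ω : Set (Space d)), φ x • g x⟫ = ⟪g, h.toLp⟫ := by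
  rw [← integral_inner (integrable_test_smul φ g), L2.inner_def]
  refine integral_congr_ae (h.coeFn_toLp.mono fun x hx => ?_)
  simp [hx, inner_smul_right, real_inner_comm]

lemma isClosed_H1 : IsClosed (H1 Ω : Set (WithLp 2 (L2 Ω × L2Vec Ω))) := by
  have hgrad (φ : 𝓓(Ω, ℝ)) (e : Space d) :
      MemLp (fun x => ⟪e, ∇ φ x⟫) 2 (volume.restrict (Ω : Set (Space d))) :=
    ((continuous_gradient_test φ).memLp_of_hasCompactSupport
      (hasCompactSupport_gradient_test φ)).const_inner e
  have htest (φ : 𝓓(Ω, ℝ)) (e : Space d) :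
      MemLp (fun x => φ x • e) 2 (volume.restrict (Ω : Set (Space d))) :=
    (φ.continuous.smul continuous_const).memLp_of_hasCompactSupport φ.hasCompactSupport.smul_right
  have heq : (H1 Ω : Set (WithLp 2 (L2 Ω × L2Vec Ω))) = ⋂ (φ : 𝓓(Ω, ℝ)), ⋂ (e : Space d),
      {p | ⟪p.fst, (hgrad φ e).toLp⟫ = -⟪p.snd, (htest φ e).toLp⟫} := by
    ext p
    simp only [Set.mem_iInter, Set.mem_ofPred_eq]
    refine forall_congr' fun φ => (ext_iff_inner_left ℝ).trans (forall_congr' fun e => ?_)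
    rw [inner_neg_right, inner_integral_smul_gradient, inner_integral_test_smul]
  rw [heq]
  exact isClosed_iInter fun φ => isClosed_iInter fun e => isClosed_eq
    ((WithLp.continuous_fst _ _ _).inner continuous_const)
    ((WithLp.continuous_snd _ _ _).inner continuous_const).neg

instance : CompleteSpace (H1 Ω) := isClosed_H1.completeSpace_coe

instance : CompleteSpace (H01 Ω) := (testH1 Ω).isClosed_topologicalClosure.completeSpace_coe

/-- The Hilbert space `H₀¹(Ω)`. It is a type of its own because the topology that instance search
finds on the nested submodule `H01 Ω` is not recognized as the one of its norm. -/
def State (Ω : Opens (Space d)) : Type := H01 Ω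

instance : NormedAddCommGroup (State Ω) := inferInstanceAs (NormedAddCommGroup (H01 Ω))

instance : InnerProductSpace ℝ (State Ω) := inferInstanceAs (InnerProductSpace ℝ (H01 Ω))

instance : CompleteSpace (State Ω) := inferInstanceAs (CompleteSpace (H01 Ω))

lemma State.norm_sq (y : State Ω) :
    ‖y‖ ^ 2 = ‖stateFn (Ω := Ω) y‖ ^ 2 + ‖stateGrad (Ω := Ω) y‖ ^ 2 :=
  WithLp.prod_norm_sq_eq_of_L2 y.1.1

/-- The embedding `H₀¹(Ω) → L²(Ω)`. -/
def stateL (Ω : Opens (Space d)) : State Ω →L[ℝ] L2 Ω :=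
  LinearMap.mkContinuous
    { toFun := fun y => stateFn (Ω := Ω) y
      map_add' := fun _ _ => rfl
      map_smul' := fun _ _ => rfl } 1 fun y => by
    rw [one_mul, ← sq_le_sq₀ (norm_nonneg _) (norm_nonneg _), State.norm_sq]
    exact le_add_of_nonneg_right (sq_nonneg _)

/-- The weak gradient `H₀¹(Ω) → L²(Ω; ℝ^d)`. -/
def gradL (Ω : Opens (Space d)) : State Ω →L[ℝ] L2Vec Ω :=
  LinearMap.mkContinuous
    { toFun := fun y => stateGrad (Ω := Ω) y
      map_add' := fun _ _ => rfl
      map_smul' := fun _ _ => rfl } 1 fun y => by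
    rw [one_mul, ← sq_le_sq₀ (norm_nonneg _) (norm_nonneg _), State.norm_sq]
    exact le_add_of_nonneg_left (sq_nonneg _)

lemma State.norm_sq_eq (y : State Ω) : ‖y‖ ^ 2 = ‖stateL Ω y‖ ^ 2 + ‖gradL Ω y‖ ^ 2 :=
  y.norm_sq

lemma dirichletForm_eq_inner (y v : State Ω) :
    dirichletForm (Ω := Ω) y v = ⟪gradL Ω y, gradL Ω v⟫ :=
  (L2.inner_def _ _).symm

lemma pairing_eq_inner (u : L2 Ω) (v : State Ω) : pairing (Ω := Ω) u v = ⟪u, stateL Ω v⟫ := by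
  rw [L2.inner_def]
  exact integral_congr_ae (.of_forall fun x => mul_comm _ _)

lemma support_test_subset (φ : 𝓓(Ω, ℝ)) : Function.support φ ⊆ Ω :=
  (subset_tsupport _).trans φ.tsupport_subset

lemma norm_gradient_eq_norm_fderiv (f : Space d → ℝ) (x : Space d) : ‖∇ f x‖ = ‖fderiv ℝ f x‖ :=
  (InnerProductSpace.toDual ℝ (Space d)).symm.norm_map _

lemma eLpNorm_fderiv_test (φ : 𝓓(Ω, ℝ)) (p : ℝ≥0∞) :
    eLpNorm (fderiv ℝ φ) p volume = eLpNorm (∇ φ) p (volume.restrict (Ω : Set (Space d))) := by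
  rw [← eLpNorm_restrict_eq_of_support_subset (f := fderiv ℝ φ)
    ((support_fderiv_subset ℝ).trans φ.tsupport_subset)]
  exact eLpNorm_congr_norm_ae (.of_forall fun x => (norm_gradient_eq_norm_fderiv φ x).symm)

lemma setIntegral_ball_eq_setIntegral_ball_zero (f : Space d → ℝ) (x : Space d) (r : ℝ) :
    ∫ y in Metric.ball x r, f y = ∫ t in Metric.ball 0 r, f (x + t) := by
  rw [← (measurePreserving_add_left volume x).setIntegral_preimage_emb
    (measurableEmbedding_addLeft x), preimage_add_ball, sub_self]

lemma eLpNorm_sub_setAverage_test_le (φ : 𝓓(Ω, ℝ)) {r : ℝ} (hr : 0 < r) :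
    eLpNorm (fun x => φ x - ⨍ t in Metric.ball 0 r, φ (x + t)) 2
        (volume.restrict (Ω : Set (Space d)))
      ≤ ENNReal.ofReal r * eLpNorm (∇ φ) 2 (volume.restrict (Ω : Set (Space d))) := by
  have hvol : volume (Metric.ball (0 : Space d) r) ≠ 0 :=
    (Metric.measure_ball_pos volume 0 hr).ne'
  have : NeZero (volume.restrict (Metric.ball (0 : Space d) r)) := ⟨by simpa using hvol⟩
  have : IsFiniteMeasure (volume.restrict (Metric.ball (0 : Space d) r)) :=
    isFiniteMeasure_restrict.2 measure_ball_lt_top.ne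
  have hφ : Integrable φ := φ.continuous.integrable_of_hasCompactSupport φ.hasCompactSupport
  have hball : ∀ᵐ t ∂volume.restrict (Metric.ball (0 : Space d) r), ‖t‖ ≤ r :=
    (ae_restrict_mem measurableSet_ball).mono fun t ht => (mem_ball_zero_iff.1 ht).le
  calc eLpNorm (fun x => φ x - ⨍ t in Metric.ball 0 r, φ (x + t)) 2
        (volume.restrict (Ω : Set (Space d)))
      ≤ eLpNorm (fun x => φ x - ⨍ t in Metric.ball 0 r, φ (x + t)) 2 volume :=
        eLpNorm_mono_measure _ Measure.restrict_le_self
    _ ≤ ENNReal.ofReal r * eLpNorm (fderiv ℝ φ) 2 volume :=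
        eLpNorm_sub_integral_add_le (φ.contDiff.of_le (by simp)) one_le_two (by simp)
          (fun x => (hφ.comp_add_left x).restrict.smul_measure (by simpa using hvol))
          (Measure.ae_smul_measure hball _)
    _ = _ := by rw [eLpNorm_fderiv_test]

variable [IsFiniteMeasure ((volume : Measure (Space d)).restrict (Ω : Set (Space d)))]

variable (Ω) in
/-- The operator that maps `f ∈ L²(Ω)`, extended by zero, to its mean values over the balls of
radius `r`. -/
def ballAverage (r : ℝ) : L2 Ω →L[ℝ] L2 Ω :=
  (volume.real (Metric.ball (0 : Space d) r))⁻¹ •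
    ballIntegral (volume.restrict (Ω : Set (Space d))) r

lemma ballAverage_ae_eq_of_test {f : L2 Ω} {φ : 𝓓(Ω, ℝ)}
    (hf : f =ᵐ[volume.restrict (Ω : Set (Space d))] φ) (r : ℝ) :
    ballAverage Ω r f =ᵐ[volume.restrict (Ω : Set (Space d))]
      fun x => ⨍ t in Metric.ball 0 r, φ (x + t) := by
  filter_upwards [Lp.coeFn_smul (volume.real (Metric.ball (0 : Space d) r))⁻¹
    (ballIntegral (volume.restrict (Ω : Set (Space d))) r f), coeFn_ballIntegral r f] with x h h'
  rw [ballAverage, smul_apply, h, Pi.smul_apply, h',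
    integral_congr_ae (ae_restrict_of_ae hf), Measure.restrict_restrict measurableSet_ball,
    ← setIntegral_eq_of_subset_of_forall_sdiff_eq_zero measurableSet_ball Set.inter_subset_left
      fun y hy => Function.notMem_support.1 fun h => hy.2 ⟨hy.1, support_test_subset φ h⟩,
    setIntegral_ball_eq_setIntegral_ball_zero, setAverage_eq]

lemma norm_ballAverage_apply_le (r : ℝ) (f : L2 Ω) :
    ‖ballAverage Ω r f‖
      ≤ (volume.real (Metric.ball (0 : Space d) r))⁻¹
        * (volume.real (Ω : Set (Space d)) * ‖f‖) := by
  rw [ballAverage, smul_apply, norm_smul, norm_inv,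
    Real.norm_of_nonneg measureReal_nonneg]
  gcongr
  simpa using norm_ballIntegral_apply_le r f

lemma isCompletelyContinuous_ballAverage (r : ℝ) : IsCompletelyContinuous (ballAverage Ω r) :=
  fun _ _ hx => (isCompletelyContinuous_ballIntegral r hx).const_smul
    (volume.real (Metric.ball (0 : Space d) r))⁻¹

lemma norm_sub_ballAverage_le_of_mem_testH1 {p : H1 Ω} (hp : p ∈ testH1 Ω) {r : ℝ} (hr : 0 < r) :
    ‖p.1.fst - ballAverage Ω r p.1.fst‖ ≤ r * ‖p.1.snd‖ := by
  obtain ⟨φ, hφ, hφ'⟩ := hp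
  have hsub : p.1.fst - ballAverage Ω r p.1.fst =ᵐ[volume.restrict (Ω : Set (Space d))]
      fun x => φ x - ⨍ t in Metric.ball 0 r, φ (x + t) := by
    filter_upwards [Lp.coeFn_sub p.1.fst (ballAverage Ω r p.1.fst), hφ,
      ballAverage_ae_eq_of_test hφ r] with x h₁ h₂ h₃
    rw [h₁, Pi.sub_apply, h₂, h₃]
  rw [← ENNReal.ofReal_le_ofReal_iff (by positivity), ENNReal.ofReal_mul hr.le, ofReal_norm,
    ofReal_norm, Lp.enorm_def, Lp.enorm_def, eLpNorm_congr_ae hsub, eLpNorm_congr_ae hφ']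
  exact eLpNorm_sub_setAverage_test_le φ hr

lemma norm_stateL_sub_ballAverage_le (y : State Ω) {r : ℝ} (hr : 0 < r) :
    ‖stateL Ω y - ballAverage Ω r (stateL Ω y)‖ ≤ r * ‖gradL Ω y‖ := by
  have hclosed : IsClosed {p : H1 Ω | ‖p.1.fst - ballAverage Ω r p.1.fst‖ ≤ r * ‖p.1.snd‖} := by
    have hfst : Continuous fun p : H1 Ω => p.1.fst :=
      (WithLp.continuous_fst _ _ _).comp continuous_subtype_val
    have hsnd : Continuous fun p : H1 Ω => p.1.snd :=
      (WithLp.continuous_snd _ _ _).comp continuous_subtype_val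
    exact isClosed_le (hfst.sub ((ballAverage Ω r).continuous.comp hfst)).norm
      (hsnd.norm.const_mul r)
  exact closure_minimal (fun p hp => norm_sub_ballAverage_le_of_mem_testH1 hp hr) hclosed y.2

lemma tendsto_measureReal_ball_atTop {E : Type*} [NormedAddCommGroup E] [NormedSpace ℝ E]
    [FiniteDimensional ℝ E] [Nontrivial E] [MeasurableSpace E] [BorelSpace E] (μ : Measure E)
    [μ.IsAddHaarMeasure] : Tendsto (fun r => μ.real (Metric.ball (0 : E) r)) atTop atTop := by
  have h : Tendsto (fun r : ℝ => r ^ Module.finrank ℝ E * μ.real (Metric.ball (0 : E) 1))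
      atTop atTop := (tendsto_pow_atTop Module.finrank_pos.ne').atTop_mul_const
    (ENNReal.toReal_pos (Metric.measure_ball_pos μ 0 one_pos).ne' measure_ball_lt_top.ne)
  exact h.congr' <| (eventually_ge_atTop 0).mono fun r hr => by
    simp [measureReal_def, Measure.addHaar_ball μ 0 hr, hr]

/-- Poincaré's inequality: averaging over large enough balls halves the norm in `L²(Ω)`. -/
lemma exists_norm_stateL_le (hd : 1 ≤ d) :
    ∃ C, 0 ≤ C ∧ ∀ y : State Ω, ‖stateL Ω y‖ ≤ C * ‖gradL Ω y‖ := by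
  have : Nontrivial (Space d) := Module.nontrivial_of_finrank_pos (R := ℝ) <| by
    rwa [finrank_euclideanSpace_fin]
  obtain ⟨r, hball, hr⟩ := (((tendsto_measureReal_ball_atTop
    (volume : Measure (Space d))).eventually_gt_atTop (2 * volume.real (Ω : Set (Space d)))).and
      (eventually_gt_atTop 0)).exists
  refine ⟨2 * r, by positivity, fun y => ?_⟩
  have hpos : 0 < volume.real (Metric.ball (0 : Space d) r) :=
    (mul_nonneg zero_le_two measureReal_nonneg).trans_lt hball
  have hhalf : ‖ballAverage Ω r (stateL Ω y)‖ ≤ ‖stateL Ω y‖ / 2 := by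
    refine (norm_ballAverage_apply_le r _).trans ?_
    rw [inv_mul_le_iff₀ hpos]
    nlinarith [norm_nonneg (stateL Ω y)]
  linarith [norm_stateL_sub_ballAverage_le y hr,
    norm_le_norm_add_norm_sub' (stateL Ω y) (ballAverage Ω r (stateL Ω y))]

lemma exists_antilipschitzWith_gradL (hd : 1 ≤ d) : ∃ K, AntilipschitzWith K (gradL Ω) := by
  obtain ⟨C, hC₀, hC⟩ := exists_norm_stateL_le (Ω := Ω) hd
  refine ⟨(C + 1).toNNReal, AddMonoidHomClass.antilipschitz_of_bound _ fun y => ?_⟩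
  rw [Real.coe_toNNReal _ (by positivity)]
  refine le_of_sq_le_sq ?_ (by positivity)
  nlinarith [y.norm_sq_eq, pow_le_pow_left₀ (norm_nonneg _) (hC y) 2,
    mul_nonneg hC₀ (sq_nonneg ‖gradL Ω y‖)]

lemma isCompletelyContinuous_stateL : IsCompletelyContinuous (stateL Ω) := by
  refine .of_forall_norm_le fun ε hε => ⟨ballAverage Ω ε ∘L stateL Ω, fun _ _ hy =>
    isCompletelyContinuous_ballAverage ε (hy.map (stateL Ω)), fun y => ?_⟩
  have hgrad : ‖gradL Ω y‖ ≤ ‖y‖ := le_of_sq_le_sq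
    (by linarith [y.norm_sq_eq, sq_nonneg ‖stateL Ω y‖]) (norm_nonneg _)
  calc ‖stateL Ω y‖
      ≤ ‖ballAverage Ω ε (stateL Ω y)‖ + ‖stateL Ω y - ballAverage Ω ε (stateL Ω y)‖ :=
        norm_le_norm_add_norm_sub' _ _
    _ ≤ ‖ballAverage Ω ε (stateL Ω y)‖ + ε * ‖y‖ := by
        grw [norm_stateL_sub_ballAverage_le y hε, hgrad]

end Sobolev

/-! ### The regularized problem and its limit -/

section Superposition

variable {α : Type*} {mα : MeasurableSpace α} {μ : Measure α} {c : ℝ≥0} {g : ℝ → ℝ}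

lemma inner_compLp (hg : LipschitzWith c g) (hg₀ : g 0 = 0) (y v : Lp ℝ 2 μ) :
    ⟪hg.compLp hg₀ y, v⟫ = ∫ x, g (y x) * v x ∂μ := by
  rw [L2.inner_def]
  refine integral_congr_ae ((hg.coeFn_compLp hg₀ y).mono fun x hx => ?_)
  beta_reduce
  rw [hx]
  exact mul_comm _ _

lemma inner_compLp_sub_nonneg (hg : LipschitzWith c g) (hg₀ : g 0 = 0) (hmono : Monotone g)
    (y z : Lp ℝ 2 μ) : 0 ≤ ⟪hg.compLp hg₀ y - hg.compLp hg₀ z, y - z⟫ := by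
  rw [L2.inner_def]
  refine integral_nonneg_of_ae ?_
  filter_upwards [hg.coeFn_compLp hg₀ y, hg.coeFn_compLp hg₀ z, Lp.coeFn_sub y z,
    Lp.coeFn_sub (hg.compLp hg₀ y) (hg.compLp hg₀ z)] with x hy hz hyz hgyz
  rw [hgyz, hyz, Pi.sub_apply, Pi.sub_apply, hy, hz]
  rcases le_total (y x) (z x) with h | h
  · exact mul_nonneg_of_nonpos_of_nonpos (sub_nonpos.2 h) (sub_nonpos.2 (hmono h))
  · exact mul_nonneg (sub_nonneg.2 h) (sub_nonneg.2 (hmono h))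

variable [IsFiniteMeasure μ]

lemma integrable_abs_of_Lp_two (y : Lp ℝ 2 μ) : Integrable (fun x => |y x|) μ :=
  ((Lp.memLp y).integrable one_le_two).abs

lemma continuous_integral_abs : Continuous fun y : Lp ℝ 2 μ => ∫ x, |y x| ∂μ := by
  have h (y : Lp ℝ 2 μ) : ∫ x, |y x| ∂μ =
      ⟪(lipschitzWith_one_norm (E := ℝ)).compLp norm_zero y, Lp.const 2 μ (1 : ℝ)⟫ := by
    rw [inner_compLp]
    refine integral_congr_ae ((Lp.coeFn_const (p := 2) (μ := μ) (1 : ℝ)).mono fun x hx => ?_)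
    beta_reduce
    rw [hx]
    simp
  simp_rw [h]
  exact ((lipschitzWith_one_norm (E := ℝ)).lipschitzWith_compLp norm_zero).continuous.inner
    continuous_const

lemma inner_compLp_sub_le (hg : LipschitzWith c g) (hg₀ : g 0 = 0) {δ : ℝ}
    (hδ : ∀ s t, g s * (t - s) ≤ |t| - |s| + δ) (y v : Lp ℝ 2 μ) :
    ⟪hg.compLp hg₀ y, v - y⟫ ≤ ∫ x, |v x| ∂μ - ∫ x, |y x| ∂μ + μ.real Set.univ * δ := by
  have hy := integrable_abs_of_Lp_two y
  have hv := integrable_abs_of_Lp_two v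
  have hvy : Integrable (fun x => |v x| - |y x|) μ := hv.sub hy
  rw [← integral_sub hv hy, ← smul_eq_mul, ← integral_const,
    ← integral_add hvy (integrable_const δ), L2.inner_def]
  refine integral_mono_ae (L2.integrable_inner _ _) (hvy.add (integrable_const δ)) ?_
  filter_upwards [hg.coeFn_compLp hg₀ y, Lp.coeFn_sub v y] with x hx hsub
  rw [hx, hsub, Pi.sub_apply]
  exact (mul_comm _ _).trans_le (hδ (y x) (v x))

end Superposition

section Arctan

open Real

lemma lipschitzWith_arctan : LipschitzWith 1 arctan := by
  refine lipschitzWith_of_nnnorm_deriv_le differentiable_arctan fun x => ?_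
  rw [Real.deriv_arctan, ← NNReal.coe_le_coe, coe_nnnorm, norm_of_nonneg (by positivity),
    NNReal.coe_one, div_le_one (by positivity)]
  linarith [sq_nonneg x]

lemma pi_div_two_mul_sub_one_le_mul_arctan {x : ℝ} (hx : 0 ≤ x) :
    π / 2 * x - 1 ≤ x * arctan x := by
  obtain rfl | hx := hx.eq_or_lt
  · simp
  have hinv : arctan x⁻¹ ≤ x⁻¹ := by
    have hdist := lipschitzWith_arctan.dist_le_mul x⁻¹ 0
    rw [arctan_zero, dist_zero_right, dist_zero_right, NNReal.coe_one, one_mul,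
      norm_of_nonneg (inv_nonneg.2 hx.le)] at hdist
    exact (le_abs_self _).trans hdist
  rw [arctan_inv_of_pos hx, inv_eq_one_div, le_div_iff₀ hx] at hinv
  linarith

/-- The regularized sign `t ↦ (2/π) arctan (γ t)`. -/
def arctanSign (γ t : ℝ) : ℝ := 2 / π * arctan (γ * t)

@[simp]
lemma arctanSign_zero (γ : ℝ) : arctanSign γ 0 = 0 := by simp [arctanSign]

lemma abs_arctanSign_le_one (γ t : ℝ) : |arctanSign γ t| ≤ 1 := by
  have harctan : |arctan (γ * t)| ≤ π / 2 :=
    abs_le.2 ⟨(neg_pi_div_two_lt_arctan _).le, (arctan_lt_pi_div_two _).le⟩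
  rw [arctanSign, abs_mul, abs_of_pos (by positivity), ← le_div_iff₀' (by positivity),
    one_div_div]
  exact harctan

lemma monotone_arctanSign {γ : ℝ} (hγ : 0 ≤ γ) : Monotone (arctanSign γ) := fun s t hst => by
  unfold arctanSign
  gcongr

lemma lipschitzWith_arctanSign (γ : ℝ) :
    LipschitzWith (‖2 / π‖₊ * (1 * ‖γ‖₊)) (arctanSign γ) :=
  (lipschitzWith_smul (2 / π)).comp (lipschitzWith_arctan.comp (lipschitzWith_smul γ))

lemma abs_sub_le_arctanSign_mul {γ : ℝ} (hγ : 0 < γ) (s : ℝ) :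
    |s| - 2 / π / γ ≤ arctanSign γ s * s := by
  have hodd : arctanSign γ s * s = 2 / π * arctan (γ * |s|) * |s| := by
    obtain hs | hs := abs_choice s <;> simp [hs, arctanSign]
  have hscale := pi_div_two_mul_sub_one_le_mul_arctan (mul_nonneg hγ.le (abs_nonneg s))
  calc |s| - 2 / π / γ = 2 / π / γ * (π / 2 * (γ * |s|) - 1) := by field_simp
    _ ≤ 2 / π / γ * (γ * |s| * arctan (γ * |s|)) := by gcongr
    _ = arctanSign γ s * s := by rw [hodd]; field_simp

lemma arctanSign_mul_sub_le {γ : ℝ} (hγ : 0 < γ) (s t : ℝ) :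
    arctanSign γ s * (t - s) ≤ |t| - |s| + 2 / π / γ := by
  have ht : arctanSign γ s * t ≤ |t| := by
    grw [← one_mul |t|, ← abs_arctanSign_le_one γ s, ← abs_mul, ← le_abs_self]
  linarith [abs_sub_le_arctanSign_mul hγ s]

lemma tendsto_mul_two_div_pi_div_atTop (c : ℝ) :
    Tendsto (fun γ => c * (2 / π / γ)) atTop (𝓝 0) := by
  simpa using ((tendsto_const_nhds (x := 2 / π)).div_atTop tendsto_id).const_mul c

end Arctan

section ControlProblem

variable {d : ℕ} {Ω : Opens (Space d)} {γ : ℝ} {u : L2 Ω} {y : State Ω} {K : ℝ≥0}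
  {yd ud ubar : L2 Ω} {ν : ℝ}

instance : SeparableSpace (L2 Ω) := by
  have : Fact ((2 : ℝ≥0∞) ≠ ⊤) := ⟨by simp⟩
  infer_instance

/-- The superposition operator `y ↦ (2/π) arctan (γ y)` on `L²(Ω)`. -/
def arctanSignL2 (Ω : Opens (Space d)) (γ : ℝ) : L2 Ω → L2 Ω :=
  (lipschitzWith_arctanSign γ).compLp (arctanSign_zero γ)

lemma lipschitzWith_arctanSignL2 (γ : ℝ) :
    LipschitzWith (‖2 / Real.pi‖₊ * (1 * ‖γ‖₊)) (arctanSignL2 Ω γ) :=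
  (lipschitzWith_arctanSign γ).lipschitzWith_compLp (arctanSign_zero γ)

lemma inner_arctanSignL2_sub_nonneg (hγ : 0 ≤ γ) (s t : L2 Ω) :
    0 ≤ ⟪arctanSignL2 Ω γ s - arctanSignL2 Ω γ t, s - t⟫ :=
  inner_compLp_sub_nonneg _ _ (monotone_arctanSign hγ) s t

lemma solvesRegularized_iff : SolvesRegularized (Ω := Ω) γ u y ↔
    SolvesEquation (gradL Ω) (stateL Ω) (arctanSignL2 Ω γ) u y := by
  refine forall_congr' fun (v : State Ω) => ?_
  rw [dirichletForm_eq_inner, pairing_eq_inner, arctanSignL2, inner_compLp,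
    ← integral_const_mul]
  simp only [arctanSign, mul_assoc]
  rfl

lemma solvesVI_iff : SolvesVI (Ω := Ω) u y ↔
    SolvesApproxVI (gradL Ω) (stateL Ω) normL1 0 u y := by
  refine forall_congr' fun (v : State Ω) => ?_
  rw [add_zero, ge_iff_le]
  change pairing (Ω := Ω) u (v - y : State Ω) ≤
    dirichletForm (Ω := Ω) y (v - y : State Ω) + _ - _ ↔ _
  rw [dirichletForm_eq_inner, pairing_eq_inner]
  rfl

lemma isLocalSolution_iff_isLocalMin {A : L2 Ω → H01 Ω → Prop} {F : H01 Ω → L2 Ω → ℝ}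
    {S : L2 Ω → H01 Ω} (hS : ∀ u y, A u y ↔ y = S u) :
    IsLocalSolution A F u ↔ IsLocalMin (fun u => F (S u) u) u := by
  simp only [IsLocalSolution, hS, exists_eq_left, IsLocalMin, IsMinFilter,
    Metric.nhds_basis_closedBall.eventually_iff, mem_closedBall_iff_norm]
  refine exists_congr fun ε => and_congr_right fun _ => forall_congr' fun u' => ?_
  exact ⟨fun h hu => h _ rfl hu, fun h y' hy' hu => hy' ▸ h hu⟩

lemma existsUnique_solvesRegularized (hG : AntilipschitzWith K (gradL Ω)) (hγ : 0 ≤ γ)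
    (u : L2 Ω) : ∃! y : State Ω, SolvesRegularized (Ω := Ω) γ u y := by
  simpa only [solvesRegularized_iff] using existsUnique_solvesEquation hG
    (lipschitzWith_arctanSignL2 γ) (inner_arctanSignL2_sub_nonneg hγ) (stateL Ω) u

/-- The control-to-state operator `u ↦ y` of the regularized equation with parameter `γ`; a junk
value where the equation is not solvable. -/
def regularizedState (Ω : Opens (Space d)) (γ : ℝ) : L2 Ω → State Ω :=
  solutionOperator (SolvesRegularized (Ω := Ω) γ)

/-- The control-to-state operator `u ↦ y` of the variational inequality; a junk value where the
inequality is not solvable. -/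
def viState (Ω : Opens (Space d)) : L2 Ω → State Ω :=
  solutionOperator (SolvesVI (Ω := Ω))

lemma isLocalSolutionPγ_iff_isLocalMin (hG : AntilipschitzWith K (gradL Ω)) (hγ : 0 ≤ γ) :
    IsLocalSolutionPγ yd ud ν ubar γ u ↔
      IsLocalMin (fun u => 1 / 2 * ‖stateL Ω (regularizedState Ω γ u) - yd‖ ^ 2
        + ν / 2 * ‖u - ud‖ ^ 2 + ‖u - ubar‖ ^ 2) u :=
  isLocalSolution_iff_isLocalMin fun u =>
    iff_eq_solutionOperator (existsUnique_solvesRegularized hG hγ u)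

variable [IsFiniteMeasure ((volume : Measure (Space d)).restrict (Ω : Set (Space d)))]

lemma SolvesEquation.solvesApproxVI_arctanSignL2 (hγ : 0 < γ)
    (h : SolvesEquation (gradL Ω) (stateL Ω) (arctanSignL2 Ω γ) u y) :
    SolvesApproxVI (gradL Ω) (stateL Ω) normL1
      (volume.real (Ω : Set (Space d)) * (2 / Real.pi / γ)) u y := by
  refine h.solvesApproxVI fun s t => ?_
  simpa [arctanSignL2, normL1] using inner_compLp_sub_le (lipschitzWith_arctanSign γ)
    (arctanSign_zero γ) (arctanSign_mul_sub_le hγ) s t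

lemma existsUnique_solvesVI (hG : AntilipschitzWith K (gradL Ω)) (u : L2 Ω) :
    ∃! y : State Ω, SolvesVI (Ω := Ω) u y := by
  simp only [solvesVI_iff]
  refine existsUnique_solvesApproxVI_zero hG continuous_integral_abs fun δ hδ => ?_
  obtain ⟨γ, hγδ, hγ⟩ := (((tendsto_mul_two_div_pi_div_atTop _).eventually_lt_const hδ).and
    (eventually_gt_atTop 0)).exists
  obtain ⟨y, hy, -⟩ := existsUnique_solvesRegularized hG hγ.le u
  refine ⟨y, fun v => ((solvesRegularized_iff.1 hy).solvesApproxVI_arctanSignL2 hγ v).trans ?_⟩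
  gcongr

lemma weakStrongTendsto_regularizedState (hG : AntilipschitzWith K (gradL Ω)) (hγ : 0 ≤ γ) :
    WeakStrongTendsto (fun _ : Unit => regularizedState Ω γ) ⊤ (regularizedState Ω γ) :=
  weakStrongTendsto_of_solvesEquation hG isCompletelyContinuous_stateL
    (inner_arctanSignL2_sub_nonneg hγ) fun u => solvesRegularized_iff.1 <|
      solutionOperator_spec (existsUnique_solvesRegularized hG hγ u).exists

lemma weakStrongTendsto_regularizedState_viState (hG : AntilipschitzWith K (gradL Ω)) :
    WeakStrongTendsto (regularizedState Ω) atTop (viState Ω) := by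
  refine weakStrongTendsto_of_solvesApproxVI hG isCompletelyContinuous_stateL
    (tendsto_mul_two_div_pi_div_atTop (volume.real (Ω : Set (Space d)))) ?_ fun u =>
      solvesVI_iff.1 <| solutionOperator_spec (existsUnique_solvesVI hG u).exists
  filter_upwards [eventually_gt_atTop 0] with γ hγ u
  exact (solvesRegularized_iff.1 <| solutionOperator_spec
    (existsUnique_solvesRegularized hG hγ.le u).exists).solvesApproxVI_arctanSignL2 hγ

lemma isLocalSolutionP_iff_isLocalMin (hG : AntilipschitzWith K (gradL Ω)) :
    IsLocalSolutionP yd ud ν u ↔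
      IsLocalMin (fun u => 1 / 2 * ‖stateL Ω (viState Ω u) - yd‖ ^ 2 + ν / 2 * ‖u - ud‖ ^ 2) u :=
  isLocalSolution_iff_isLocalMin fun u => iff_eq_solutionOperator (existsUnique_solvesVI hG u)

end ControlProblem

end VIControl

end

theorem theoremB2_general {d : ℕ} (hd : 1 ≤ d) {Ω : TopologicalSpace.Opens (VIControl.Space d)}
    (hΩ : volume (Ω : Set (VIControl.Space d)) ≠ ⊤) (yd ud : VIControl.L2 Ω) {ν : ℝ} (hν : 0 ≤ ν)
    {ubar : VIControl.L2 Ω} (hubar : VIControl.IsLocalSolutionP yd ud ν ubar) :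
    ∃ u : ℝ → VIControl.L2 Ω,
      (∀ γ : ℝ, 0 < γ → VIControl.IsLocalSolutionPγ yd ud ν ubar γ (u γ)) ∧
        Tendsto u atTop (𝓝 ubar) := by
  have : IsFiniteMeasure (volume.restrict (Ω : Set (VIControl.Space d))) :=
    isFiniteMeasure_restrict.2 hΩ
  obtain ⟨K, hG⟩ := VIControl.exists_antilipschitzWith_gradL (Ω := Ω) hd
  obtain ⟨u, hu, hlim⟩ :=
    (VIControl.weakStrongTendsto_regularizedState_viState hG).exists_isLocalMin_tendsto
      (Ioi_mem_atTop 0)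
      (fun γ hγ => VIControl.weakStrongTendsto_regularizedState hG (Set.mem_Ioi.1 hγ).le)
      (Φ := fun y => 1 / 2 * ‖VIControl.stateL Ω y - yd‖ ^ 2) (by fun_prop)
      (fun y => by positivity) (div_nonneg hν zero_le_two)
      ((VIControl.isLocalSolutionP_iff_isLocalMin hG).1 hubar)
  exact ⟨u, fun γ hγ => (VIControl.isLocalSolutionPγ_iff_isLocalMin hG hγ.le).2 (hu γ hγ), hlim⟩

theorem theoremB2 (d : ℕ) (hd : 1 ≤ d)
    (Ω : TopologicalSpace.Opens (VIControl.Space d))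
    (hΩ : Bornology.IsBounded (Ω : Set (VIControl.Space d)))
    (yd ud : VIControl.L2 Ω) (ν : ℝ) (hν : 0 < ν)
    (ubar : VIControl.L2 Ω) (hubar : VIControl.IsLocalSolutionP yd ud ν ubar) :
    ∃ u : ℝ → VIControl.L2 Ω,
      (∀ γ : ℝ, 0 < γ → VIControl.IsLocalSolutionPγ yd ud ν ubar γ (u γ)) ∧
      Tendsto u atTop (𝓝 ubar) :=
  theoremB2_general hd hΩ.measure_lt_top.ne yd ud hν.le hubar
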